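/- \textbf{Corollary (Gaifman normal form without negation).} Let $\tau$ be a finite relational signature. For a $\tau$-structure $\mathfrak A$ let $d$ be the distance in its Gaifman graph, in which two distinct elements are adjacent iff they occur together in a tuple of some relation of $\mathfrak A$ (so $d=\infty$ between different components), and let $B_r(a)=\{b : d(a,b)\le r\}$ for $r\in\mathbb N$. Consider formulae built from $\tau$-literals $R\bar x$, $\neg R\bar x$, $x=y$, $x\ne y$ by means of $\land$, $\lor$ and ball quantifiers $\exists z\in B_s(y)$, $\forall z\in B_s(y)$ with $s\in\mathbb N$ and pairwise distinct bound variables. Such a formula $\varphi$ is \emph{$r$-local} around its free variables if, in the graph with an edge $z\to y$ of length $s$ for every quantifier $Qz\in B_s(y)$ of $\varphi$, every path that ends in a free variable has total length at most $r$. A \emph{basic local sentence} is a sentence of the form $$\exists y_1\dots\exists y_m\Big(\bigwedge_{i<j}d(y_i,y_j)>2r\;\land\;\bigwedge_{i\le m}\varphi(y_i)\Big)\quad\text{or}\quad \forall y_1\dots\forall y_m\Big(\bigvee_{i<j}d(y_i,y_j)\le 2r\;\lor\;\bigvee_{i\le m}\varphi(y_i)\Big),$$ where $m\ge 1$, $r\in\mathbb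 N$ and $\varphi(y)$ is $r$-local around its only free variable $y$. A \emph{local sentence} is a positive Boolean combination of basic local sentences (that is, one built from them by $\land$ and $\lor$). An occurrence of a relation symbol is \emph{positive} if it is behind an even number of negations, and \emph{negative} otherwise (an implication $\alpha\to\beta$ being read as $\neg\alpha\lor\beta$); occurrences that are implicit in the distance formulae, i.e. in ball quantifiers and in the conditions $d(y_i,y_j)>2r$, $d(y_i,y_j)\le 2r$, are not counted in local sentences. Then for every first-order $\tau$-sentence $\psi$ there is a local sentence $\psi'$ such that $\mathfrak A\models\psi\iff\mathfrak A\models\psi'$ for all $\tau$-structures $\mathfrak A$ with non-empty universe, and such that, for every relation symbol $R\in\tau$: if $R$ has no negative occurrence in $\psi$, then $R$ has no negative occurrence in $\psi'$; and if $R$ has no positive occurrence in $\psi$, then $R$ has no positive occurrence in $\psi'$. -/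

import Mathlib

universe u v w

namespace Gaifman

/-- The Gaifman graph of an `L`-structure: two distinct elements are adjacent iff they occur
together in some tuple of some relation. -/
def gaifmanGraph (L : FirstOrder.Language.{u, v}) (M : Type w) [L.Structure M] : SimpleGraph M where
  Adj a b := a ≠ b ∧ ∃ (l : ℕ) (R : L.Relations l) (c : Fin l → M),
    FirstOrder.Language.Structure.RelMap R c ∧ a ∈ Set.range c ∧ b ∈ Set.range c
  symm := ⟨fun _ _ h => ⟨h.1.symm, h.2.imp fun _ h => h.imp fun _ h => h.imp fun _ h =>
    ⟨h.1, h.2.2, h.2.1⟩⟩⟩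
  loopless := ⟨fun _ h => h.1 rfl⟩

/-- Distance in the Gaifman graph, with value `⊤` between different connected components. -/
noncomputable def gdist (L : FirstOrder.Language.{u, v}) {M : Type w} [L.Structure M] (a b : M) : ℕ∞ :=
  (gaifmanGraph L M).edist a b

/-- Formulae with free variables `x₀, …, xₙ₋₁`, built from literals (also equalities and
inequalities) by means of conjunction, disjunction and the ball quantifiers
`∃ z ∈ B_r(x_y)` and `∀ z ∈ B_r(x_y)`. As in Mathlib's `BoundedFormula`, the variable bound by a
quantifier in a formula with `n` free variables is `xₙ`; thus bound variables are never reused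
within their scope. -/
inductive BallFormula (L : FirstOrder.Language.{u, v}) : ℕ → Type v
  | eq {n : ℕ} (i j : Fin n) : BallFormula L n
  | ne {n : ℕ} (i j : Fin n) : BallFormula L n
  | rel {n l : ℕ} (R : L.Relations l) (x : Fin l → Fin n) : BallFormula L n
  | nrel {n l : ℕ} (R : L.Relations l) (x : Fin l → Fin n) : BallFormula L n
  | and {n : ℕ} (φ θ : BallFormula L n) : BallFormula L n
  | or {n : ℕ} (φ θ : BallFormula L n) : BallFormula L n
  | exBall {n : ℕ} (r : ℕ) (y : Fin n) (φ : BallFormula L (n + 1)) : BallFormula L n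
  | allBall {n : ℕ} (r : ℕ) (y : Fin n) (φ : BallFormula L (n + 1)) : BallFormula L n

namespace BallFormula

variable {L : FirstOrder.Language.{u, v}}

/-- Boolean semantics. -/
def Realize {M : Type w} [L.Structure M] : {n : ℕ} → BallFormula L n → (Fin n → M) → Prop
  | _, eq i j, a => a i = a j
  | _, ne i j, a => a i ≠ a j
  | _, rel R x, a => FirstOrder.Language.Structure.RelMap R (fun k => a (x k))
  | _, nrel R x, a => ¬ FirstOrder.Language.Structure.RelMap R (fun k => a (x k))
  | _, and φ θ, a => φ.Realize a ∧ θ.Realize a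
  | _, or φ θ, a => φ.Realize a ∨ θ.Realize a
  | _, exBall r y φ, a => ∃ b : M, gdist L (a y) b ≤ r ∧ φ.Realize (Fin.snoc a b)
  | _, allBall r y φ, a => ∀ b : M, gdist L (a y) b ≤ r → φ.Realize (Fin.snoc a b)

/-- `d i` is the total length of the path in the quantification dag that leads from the variable
`xᵢ` to a free variable of the whole formula. A ball quantifier of radius `s` around `x_y` adds an
edge of length `s` from the new variable to `x_y`. All path lengths have to be at most `r`. -/
def PathsLE (r : ℕ) : {n : ℕ} → (Fin n → ℕ) → BallFormula L n → Prop
  | _, _, eq _ _ => True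
  | _, _, ne _ _ => True
  | _, _, rel _ _ => True
  | _, _, nrel _ _ => True
  | _, d, and φ θ => φ.PathsLE r d ∧ θ.PathsLE r d
  | _, d, or φ θ => φ.PathsLE r d ∧ θ.PathsLE r d
  | _, d, exBall s y φ => d y + s ≤ r ∧ φ.PathsLE r (Fin.snoc d (d y + s))
  | _, d, allBall s y φ => d y + s ≤ r ∧ φ.PathsLE r (Fin.snoc d (d y + s))

/-- The formula is `r`-local around its free variables. -/
def IsLocal (r : ℕ) {n : ℕ} (φ : BallFormula L n) : Prop :=
  φ.PathsLE r (fun _ => 0)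

/-- The relation symbol `S` has a positive (`pol = true`) or negative (`pol = false`) occurrence
in the formula. Distances in ball quantifiers are not counted. -/
def Occurs (S : Σ l, L.Relations l) (pol : Bool) : {n : ℕ} → BallFormula L n → Prop
  | _, eq _ _ => False
  | _, ne _ _ => False
  | _, rel R _ => (⟨_, R⟩ : Σ l, L.Relations l) = S ∧ pol = true
  | _, nrel R _ => (⟨_, R⟩ : Σ l, L.Relations l) = S ∧ pol = false
  | _, and φ θ => φ.Occurs S pol ∨ θ.Occurs S pol
  | _, or φ θ => φ.Occurs S pol ∨ θ.Occurs S pol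
  | _, exBall _ _ φ => φ.Occurs S pol
  | _, allBall _ _ φ => φ.Occurs S pol

end BallFormula

/-- Local sentences: positive Boolean combinations of basic local sentences. For `m ≥ 1` and an
`r`-local formula `φ(y)` the basic local sentences are
`∃ y₁ … yₘ (⋀_{i<j} d(yᵢ, yⱼ) > 2r ∧ ⋀ᵢ φ(yᵢ))` and its dual
`∀ y₁ … yₘ (⋁_{i<j} d(yᵢ, yⱼ) ≤ 2r ∨ ⋁ᵢ φ(yᵢ))`. -/
inductive LocalSentence (L : FirstOrder.Language.{u, v}) : Type v
  | exScattered (r m : ℕ) (hm : 1 ≤ m) (φ : BallFormula L 1) (hφ : φ.IsLocal r) : LocalSentence L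
  | allScattered (r m : ℕ) (hm : 1 ≤ m) (φ : BallFormula L 1) (hφ : φ.IsLocal r) : LocalSentence L
  | and (χ₁ χ₂ : LocalSentence L) : LocalSentence L
  | or (χ₁ χ₂ : LocalSentence L) : LocalSentence L

namespace LocalSentence

variable {L : FirstOrder.Language.{u, v}}

/-- Boolean semantics. -/
def Realize (M : Type w) [L.Structure M] : LocalSentence L → Prop
  | exScattered r m _ φ _ => ∃ y : Fin m → M,
      (∀ i j : Fin m, i < j → ((2 * r : ℕ) : ℕ∞) < gdist L (y i) (y j)) ∧
        ∀ i : Fin m, φ.Realize (fun _ => y i)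
  | allScattered r m _ φ _ => ∀ y : Fin m → M,
      (∃ i j : Fin m, i < j ∧ gdist L (y i) (y j) ≤ ((2 * r : ℕ) : ℕ∞)) ∨
        ∃ i : Fin m, φ.Realize (fun _ => y i)
  | and χ₁ χ₂ => χ₁.Realize M ∧ χ₂.Realize M
  | or χ₁ χ₂ => χ₁.Realize M ∨ χ₂.Realize M

/-- Positive and negative occurrences, without those inside distance formulae. -/
def Occurs (S : Σ l, L.Relations l) (pol : Bool) : LocalSentence L → Prop
  | exScattered _ _ _ φ _ => φ.Occurs S pol
  | allScattered _ _ _ φ _ => φ.Occurs S pol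
  | and χ₁ χ₂ => χ₁.Occurs S pol ∨ χ₂.Occurs S pol
  | or χ₁ χ₂ => χ₁.Occurs S pol ∨ χ₂.Occurs S pol

end LocalSentence

/-- The relation symbol `S` has a positive (`pol = true`) or negative (`pol = false`) occurrence
in the first-order formula, i.e. one behind an even (odd) number of negations, where `φ → θ` is read
as `¬ φ ∨ θ`. -/
def FOOccurs {L : FirstOrder.Language.{u, v}} {α : Type*} (S : Σ l, L.Relations l) :
    Bool → {n : ℕ} → L.BoundedFormula α n → Prop
  | _, _, .falsum => False
  | _, _, .equal _ _ => False
  | pol, _, .rel R _ => (⟨_, R⟩ : Σ l, L.Relations l) = S ∧ pol = true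
  | pol, _, .imp φ θ => FOOccurs S (!pol) φ ∨ FOOccurs S pol θ
  | pol, _, .all φ => FOOccurs S pol φ

end Gaifman

namespace Gaifman

open FirstOrder FirstOrder.Language

variable {L : FirstOrder.Language.{u, v}}

/-! Since negation is restricted, equality of local types is replaced throughout by one-sided
simulation. In the game behind `LocalSim`, Spoiler may move in both structures, but only literals
with signs in `P` have to be preserved from left to right. Distances are respected in both
directions all the same, because walking along a path costs rounds and equality is preserved both
ways (`LocalSim.near_iff`). Hence simulations on far apart sets can be united (`LocalSim.iUnion`).
`GlobalSim` demands in addition that any few further elements of either structure have counterparts.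

A global simulation with enough resources survives an arbitrary move (`exists_globalSim_snoc`), so
it preserves first-order formulae with signs in `P` (`exists_globalSim_realize`). To answer a move
`c`, colour the elements by their local types and choose a scale at which finitely many
representatives on each side are close to every element whose colour is not frequent. The simulation
at hand maps the representatives of `A` and `c` into `B`, and those of `B` into `A`. The two maps
need not be inverse to each other; a Cantor–Bernstein matching of clusters merges them into one
simulation that comes close to both domains (`exists_common_simulation`). It contains a pair near
`c`, whence the answer. Later elements are near this simulation or have a frequent colour, and then
one of many scattered counterparts is still free.

Conversely, preservation of finitely many basic local sentences with signs in `P` yields a global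
simulation on the empty set (`exists_sentences_globalSim`). Such a sentence imposes the same formula
on all its witnesses, so it cannot assign a type to each of them. It can say that there are `|I|`
scattered elements, each with one of the types in `I`; this is Hall's condition, and
`exists_scattered_transversal` returns one witness per type.

The normal form is then the disjunction, over the models of `ψ`, of the conjunction of those
sentences that hold in the model. -/

/-! ### Bounded distance in the Gaifman graph -/

/-- Distance at most `s` in the Gaifman graph. -/
def Near (L : FirstOrder.Language.{u, v}) {M : Type w} [L.Structure M] (s : ℕ) (a b : M) : Prop :=
  gdist L a b ≤ s

section Near

variable {M : Type w} [L.Structure M]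

theorem Near.refl (s : ℕ) (a : M) : Near L s a a := by
  simp [Near, gdist, SimpleGraph.edist_self]

theorem Near.symm {s : ℕ} {a b : M} (h : Near L s a b) : Near L s b a := by
  rw [Near, gdist, SimpleGraph.edist_comm]; exact h

theorem Near.mono {s t : ℕ} (hst : s ≤ t) {a b : M} (h : Near L s a b) : Near L t a b :=
  le_trans h (by exact_mod_cast hst)

theorem Near.trans {s t : ℕ} {a b c : M} (h : Near L s a b) (h' : Near L t b c) :
    Near L (s + t) a c := by
  rw [Near]; push_cast
  exact SimpleGraph.edist_triangle.trans (add_le_add h h')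

theorem near_zero {a b : M} : Near L 0 a b ↔ a = b := by
  simp [Near, gdist, SimpleGraph.edist_eq_zero_iff]

theorem Near.exists_succ {s : ℕ} {a b : M} (h : Near L (s + 1) a b) :
    ∃ c, Near L s a c ∧ Near L 1 c b := by
  -- The walk is taken from `b` to `a`, so that its first edge is the last step towards `b`.
  have hne : (gaifmanGraph L M).edist b a ≠ ⊤ := by
    have := h.symm
    exact ne_top_of_le_ne_top (ENat.natCast_ne_top _) this
  obtain ⟨p, hp⟩ := SimpleGraph.exists_walk_of_edist_ne_top hne
  have hl : p.length ≤ s + 1 := by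
    have : (p.length : ℕ∞) ≤ ((s + 1 : ℕ) : ℕ∞) := hp ▸ h.symm
    exact_mod_cast this
  cases p with
  | nil => exact ⟨_, Near.refl _ _, Near.refl _ _⟩
  | cons hadj q =>
    refine ⟨_, Near.symm (Near.mono (s := q.length) ?_ (SimpleGraph.edist_le q)), Near.symm ?_⟩
    · simpa using hl
    · have := SimpleGraph.edist_eq_one_iff_adj.2 hadj
      simp [Near, gdist, this]

theorem near_one_of_relMap {l : ℕ} {R : L.Relations l} {c : Fin l → M}
    (h : Structure.RelMap R c) (i j : Fin l) : Near L 1 (c i) (c j) := by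
  by_cases hij : c i = c j
  · rw [hij]; exact Near.refl _ _
  · have : (gaifmanGraph L M).Adj (c i) (c j) := ⟨hij, l, R, c, h, ⟨i, rfl⟩, ⟨j, rfl⟩⟩
    simp [Near, gdist, SimpleGraph.edist_eq_one_iff_adj.2 this]

end Near

/-! ### Local simulations -/

/-- Sets of signed relation symbols. -/
abbrev Signs (L : FirstOrder.Language.{u, v}) := (Σ l, L.Relations l) → Bool → Prop

/-- The signs that occur in the negation of a formula. -/
def Signs.dual (P : Signs L) : Signs L := fun S b => P S (!b)

@[simp] theorem Signs.dual_dual (P : Signs L) : P.dual.dual = P := by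
  funext S b; simp [Signs.dual]

section Sim

variable {A B C : Type w} [L.Structure A] [L.Structure B] [L.Structure C]

/-- The literals with signs in `P` are preserved from left to right by the pairs in `p`. -/
def PreservesLiterals (P : Signs L) (p : Set (A × B)) : Prop :=
  (∀ x ∈ p, ∀ y ∈ p, x.1 = y.1 ↔ x.2 = y.2) ∧
  ∀ (l : ℕ) (R : L.Relations l) (c : Fin l → A × B), (∀ i, c i ∈ p) →
    (P ⟨l, R⟩ true → Structure.RelMap R (fun i => (c i).1) →
      Structure.RelMap R (fun i => (c i).2)) ∧
    (P ⟨l, R⟩ false → Structure.RelMap R (fun i => (c i).2) →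
      Structure.RelMap R (fun i => (c i).1))

/-- Duplicator survives `k` rounds of the game on the pairs `p` in which every move is made
at distance at most one from an element chosen before. -/
def LocalSim (P : Signs L) : ℕ → Set (A × B) → Prop
  | 0, p => PreservesLiterals P p
  | k + 1, p => LocalSim P k p ∧
      (∀ x ∈ p, ∀ c, Near L 1 x.1 c → ∃ d, Near L 1 x.2 d ∧ LocalSim P k (insert (c, d) p)) ∧
      (∀ x ∈ p, ∀ d, Near L 1 x.2 d → ∃ c, Near L 1 x.1 c ∧ LocalSim P k (insert (c, d) p))

variable {P : Signs L}

theorem PreservesLiterals.subset {p q : Set (A × B)} (h : PreservesLiterals P q) (hpq : p ⊆ q) :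
    PreservesLiterals P p :=
  ⟨fun x hx y hy => h.1 x (hpq hx) y (hpq hy), fun l R c hc => h.2 l R c fun i => hpq (hc i)⟩

theorem LocalSim.subset {k : ℕ} {p q : Set (A × B)} (h : LocalSim P k q) (hpq : p ⊆ q) :
    LocalSim P k p := by
  induction k generalizing p q with
  | zero => exact PreservesLiterals.subset h hpq
  | succ k ih =>
    refine ⟨ih h.1 hpq, fun x hx c hc => ?_, fun x hx d hd => ?_⟩
    · obtain ⟨d, hd, hs⟩ := h.2.1 x (hpq hx) c hc
      exact ⟨d, hd, ih hs (Set.insert_subset_insert hpq)⟩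
    · obtain ⟨c, hc, hs⟩ := h.2.2 x (hpq hx) d hd
      exact ⟨c, hc, ih hs (Set.insert_subset_insert hpq)⟩

theorem LocalSim.mono {k l : ℕ} (hkl : k ≤ l) {p : Set (A × B)} (h : LocalSim P l p) :
    LocalSim P k p := by
  induction hkl with
  | refl => exact h
  | step _ ih => exact ih h.1

theorem LocalSim.preservesLiterals {k : ℕ} {p : Set (A × B)} (h : LocalSim P k p) :
    PreservesLiterals P p :=
  h.mono (Nat.zero_le k)

theorem LocalSim.swap {k : ℕ} {p : Set (A × B)} (h : LocalSim P k p) :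
    LocalSim P.dual k (Prod.swap ⁻¹' p) := by
  induction k generalizing p with
  | zero =>
    refine ⟨fun x hx y hy => (h.1 x.swap hx y.swap hy).symm, fun l R c hc => ?_⟩
    have := h.2 l R (fun i => (c i).swap) hc
    exact ⟨this.2, this.1⟩
  | succ k ih =>
    have key : ∀ (c : A) (d : B),
        (insert (d, c) (Prod.swap ⁻¹' p) : Set (B × A)) ⊆ Prod.swap ⁻¹' (insert (c, d) p) := by
      rintro c d x (rfl | hx)
      · exact Or.inl rfl
      · exact Or.inr hx
    refine ⟨ih h.1, fun x hx c hc => ?_, fun x hx d hd => ?_⟩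
    · obtain ⟨d, hd, hs⟩ := h.2.2 x.swap hx c hc
      exact ⟨d, hd, (ih hs).subset (key _ _)⟩
    · obtain ⟨c, hc, hs⟩ := h.2.1 x.swap hx d hd
      exact ⟨c, hc, (ih hs).subset (key _ _)⟩

theorem LocalSim.of_swap {k : ℕ} {p : Set (A × B)} (h : LocalSim P.dual k (Prod.swap ⁻¹' p)) :
    LocalSim P k p := by
  have := h.swap
  rw [Signs.dual_dual] at this
  exact this

/-- Duplicator passes each move on through the structure in the middle. -/
theorem LocalSim.comp {k : ℕ} {p : Set (A × B)} {q : Set (B × C)} (hp : LocalSim P k p)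
    (hq : LocalSim P k q) : LocalSim P k {z : A × C | ∃ b, (z.1, b) ∈ p ∧ (b, z.2) ∈ q} := by
  induction k generalizing p q with
  | zero =>
    refine ⟨?_, fun l R c hc => ?_⟩
    · rintro x ⟨b, hb, hb'⟩ y ⟨b₁, hb₁, hb₁'⟩
      exact (hp.1 _ hb _ hb₁).trans (hq.1 _ hb' _ hb₁')
    · choose b hb hb' using hc
      have h₁ := hp.2 l R (fun i => ((c i).1, b i)) hb
      have h₂ := hq.2 l R (fun i => (b i, (c i).2)) hb'
      exact ⟨fun hP h => h₂.1 hP (h₁.1 hP h), fun hP h => h₁.2 hP (h₂.2 hP h)⟩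
  | succ k ih =>
    have key : ∀ (a : A) (b : B) (c : C),
        (insert (a, c) {z : A × C | ∃ b, (z.1, b) ∈ p ∧ (b, z.2) ∈ q}) ⊆
          {z : A × C | ∃ b', (z.1, b') ∈ insert (a, b) p ∧ (b', z.2) ∈ insert (b, c) q} := by
      rintro a b c z (rfl | ⟨b', h, h'⟩)
      · exact ⟨b, Or.inl rfl, Or.inl rfl⟩
      · exact ⟨b', Or.inr h, Or.inr h'⟩
    refine ⟨ih hp.1 hq.1, ?_, ?_⟩
    · rintro x ⟨b, hb, hb'⟩ a ha
      obtain ⟨b₁, h₁, hs₁⟩ := hp.2.1 _ hb a ha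
      obtain ⟨c₁, h₂, hs₂⟩ := hq.2.1 _ hb' b₁ h₁
      exact ⟨c₁, h₂, (ih hs₁ hs₂).subset (key _ _ _)⟩
    · rintro x ⟨b, hb, hb'⟩ c hc
      obtain ⟨b₁, h₁, hs₁⟩ := hq.2.2 _ hb' c hc
      obtain ⟨a₁, h₂, hs₂⟩ := hp.2.2 _ hb b₁ h₁
      exact ⟨a₁, h₂, (ih hs₂ hs₁).subset (key _ _ _)⟩

theorem LocalSim.comp_singleton {k : ℕ} {a : A} {b : B} {c : C} (hp : LocalSim P k {(a, b)})
    (hq : LocalSim P k {(b, c)}) : LocalSim P k {(a, c)} :=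
  (hp.comp hq).subset (by rintro _ rfl; exact ⟨b, rfl, rfl⟩)

/-- Moves at a larger distance cost more rounds. -/
theorem LocalSim.exists_move {k s : ℕ} {p : Set (A × B)} (h : LocalSim P (k + s) p) {x : A × B}
    (hx : x ∈ p) {c : A} (hc : Near L s x.1 c) :
    ∃ d, Near L s x.2 d ∧ LocalSim P k (insert (c, d) p) := by
  induction s generalizing k c with
  | zero =>
    rw [near_zero] at hc
    subst hc
    refine ⟨x.2, Near.refl _ _, ?_⟩
    rwa [Set.insert_eq_of_mem hx]
  | succ s ih =>
    obtain ⟨c', hc', h1⟩ := hc.exists_succ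
    rw [show k + (s + 1) = (k + 1) + s by omega] at h
    obtain ⟨d', hd', hs⟩ := ih h hc'
    obtain ⟨d, hd, hs'⟩ := hs.2.1 (c', d') (Or.inl rfl) c h1
    exact ⟨d, hd'.trans hd, hs'.subset (Set.insert_subset_insert (Set.subset_insert _ _))⟩

/-- Spoiler walks from `x.1` to `y.1`; preservation of equality forces the answering walk to end in
`y.2`. -/
theorem LocalSim.near_snd {k s : ℕ} (hs : s ≤ k) {p : Set (A × B)} (h : LocalSim P k p)
    {x y : A × B} (hx : x ∈ p) (hy : y ∈ p) (hxy : Near L s x.1 y.1) : Near L s x.2 y.2 := by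
  obtain ⟨d, hd, h'⟩ := LocalSim.exists_move (k := 0) (h.mono (by omega : 0 + s ≤ k)) hx hxy
  have := (h'.preservesLiterals.1 (y.1, d) (Or.inl rfl) y (Or.inr hy)).1 rfl
  exact this ▸ hd

theorem LocalSim.near_iff {k s : ℕ} (hs : s ≤ k) {p : Set (A × B)} (h : LocalSim P k p)
    {x y : A × B} (hx : x ∈ p) (hy : y ∈ p) : Near L s x.1 y.1 ↔ Near L s x.2 y.2 :=
  ⟨h.near_snd hs hx hy, h.swap.near_snd hs (x := x.swap) (y := y.swap) hx hy⟩

/-- Simulations on far apart sets can be united. -/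
theorem LocalSim.iUnion {ι : Type*} [Nonempty ι] {k : ℕ} {p : ι → Set (A × B)}
    (h : ∀ i, LocalSim P k (p i))
    (hfar : ∀ i j, i ≠ j → ∀ x ∈ p i, ∀ y ∈ p j,
      ¬ Near L (2 * k + 1) x.1 y.1 ∧ ¬ Near L (2 * k + 1) x.2 y.2) :
    LocalSim P k (⋃ i, p i) := by
  classical
  induction k generalizing p with
  | zero =>
    refine ⟨?_, fun l R c hc => ?_⟩
    · intro x hx y hy
      obtain ⟨i, hi⟩ := Set.mem_iUnion.1 hx
      obtain ⟨j, hj⟩ := Set.mem_iUnion.1 hy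
      by_cases hij : i = j
      · subst hij; exact (h i).1 x hi y hj
      · have := hfar i j hij x hi y hj
        refine iff_of_false (fun h => this.1 ?_) (fun h => this.2 ?_) <;>
        · rw [h]; exact Near.refl _ _
    · have key : (Structure.RelMap R (fun i => (c i).1) ∨ Structure.RelMap R (fun i => (c i).2)) →
          ∃ i, ∀ m, c m ∈ p i := by
        intro hR
        rcases Nat.eq_zero_or_pos l with rfl | hl
        -- Nullary relations involve no element, so some simulation must exist to preserve them.
        · exact ⟨Classical.arbitrary ι, fun m => m.elim0⟩
        · obtain ⟨i, hi⟩ := Set.mem_iUnion.1 (hc ⟨0, hl⟩)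
          refine ⟨i, fun m => ?_⟩
          obtain ⟨j, hj⟩ := Set.mem_iUnion.1 (hc m)
          by_cases hij : i = j
          · rwa [hij]
          · exfalso
            have := hfar i j hij _ hi _ hj
            rcases hR with hR | hR
            · exact this.1 (near_one_of_relMap hR ⟨0, hl⟩ m)
            · exact this.2 (near_one_of_relMap hR ⟨0, hl⟩ m)
      refine ⟨fun hP hR => ?_, fun hP hR => ?_⟩
      · obtain ⟨i, hi⟩ := key (Or.inl hR)
        exact ((h i).2 l R c hi).1 hP hR
      · obtain ⟨i, hi⟩ := key (Or.inr hR)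
        exact ((h i).2 l R c hi).2 hP hR
  | succ k ih =>
    -- Distance above `2k+2` is enough: a new pair is one step away from its own part, which leaves
    -- `2k+1` for `k` rounds.
    have hfar' : ∀ i j, i ≠ j → ∀ x ∈ p i, ∀ y ∈ p j,
        ¬ Near L (2 * k + 1 + 1) x.1 y.1 ∧ ¬ Near L (2 * k + 1 + 1) x.2 y.2 :=
      fun i j hij x hx y hy =>
        ⟨fun hn => (hfar i j hij x hx y hy).1 (hn.mono (by omega)),
         fun hn => (hfar i j hij x hx y hy).2 (hn.mono (by omega))⟩
    have key : ∀ i, ∀ x ∈ p i, ∀ c d, Near L 1 x.1 c → Near L 1 x.2 d →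
        LocalSim P k (insert (c, d) (p i)) → LocalSim P k (insert (c, d) (⋃ i, p i)) := by
      intro i x hx c d hc hd hs
      have hcd : ∀ j, i ≠ j → ∀ y ∈ p j,
          ¬ Near L (2 * k + 1) c y.1 ∧ ¬ Near L (2 * k + 1) d y.2 := by
        intro j hij y hy
        have := hfar' i j hij x hx y hy
        exact ⟨fun hn => this.1 ((hc.trans hn).mono (by omega)),
          fun hn => this.2 ((hd.trans hn).mono (by omega))⟩
      refine (ih (p := Function.update p i (insert (c, d) (p i))) ?_ ?_).subset ?_
      · intro j
        by_cases hj : j = i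
        · subst hj; simpa using hs
        · rw [Function.update_of_ne hj]; exact (h j).1
      · intro j j' hjj' y hy z hz
        by_cases hj : j = i
        · subst hj
          rw [Function.update_self] at hy
          rw [Function.update_of_ne hjj'.symm] at hz
          rcases hy with rfl | hy
          · exact hcd j' hjj' z hz
          · have := hfar' _ _ hjj' y hy z hz
            exact ⟨fun hn => this.1 (hn.mono (by omega)), fun hn => this.2 (hn.mono (by omega))⟩
        · rw [Function.update_of_ne hj] at hy
          by_cases hj' : j' = i
          · subst hj'
            rw [Function.update_self] at hz
            rcases hz with rfl | hz
            · have := hcd j (Ne.symm hjj') y hy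
              exact ⟨fun hn => this.1 hn.symm, fun hn => this.2 hn.symm⟩
            · have := hfar' _ _ hjj' y hy z hz
              exact ⟨fun hn => this.1 (hn.mono (by omega)), fun hn => this.2 (hn.mono (by omega))⟩
          · rw [Function.update_of_ne hj'] at hz
            have := hfar' _ _ hjj' y hy z hz
            exact ⟨fun hn => this.1 (hn.mono (by omega)), fun hn => this.2 (hn.mono (by omega))⟩
      · rintro y (rfl | hy)
        · exact Set.mem_iUnion.2 ⟨i, by simp⟩
        · obtain ⟨j, hj⟩ := Set.mem_iUnion.1 hy
          refine Set.mem_iUnion.2 ⟨j, ?_⟩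
          by_cases hji : j = i
          · subst hji; simp [hj]
          · rwa [Function.update_of_ne hji]
    refine ⟨ih (fun i => (h i).1) fun i j hij x hx y hy => ?_, ?_, ?_⟩
    · have := hfar' i j hij x hx y hy
      exact ⟨fun hn => this.1 (hn.mono (by omega)), fun hn => this.2 (hn.mono (by omega))⟩
    · intro x hx c hc
      obtain ⟨i, hi⟩ := Set.mem_iUnion.1 hx
      obtain ⟨d, hd, hs⟩ := (h i).2.1 x hi c hc
      exact ⟨d, hd, key i x hi c d hc hd hs⟩
    · intro x hx d hd
      obtain ⟨i, hi⟩ := Set.mem_iUnion.1 hx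
      obtain ⟨c, hc, hs⟩ := (h i).2.2 x hi d hd
      exact ⟨c, hc, key i x hi c d hc hd hs⟩

theorem LocalSim.insert_far {k : ℕ} {p : Set (A × B)} {x : A × B} (hp : LocalSim P k p)
    (hx : LocalSim P k {x})
    (hfar : ∀ y ∈ p, ¬ Near L (2 * k + 1) y.1 x.1 ∧ ¬ Near L (2 * k + 1) y.2 x.2) :
    LocalSim P k (insert x p) := by
  refine (LocalSim.iUnion (p := fun b : Bool => cond b p {x}) ?_ ?_).subset ?_
  · rintro (_ | _)
    exacts [hx, hp]
  · rintro (_ | _) (_ | _) hij y hy z hz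
    · exact absurd rfl hij
    · obtain rfl : y = x := hy
      exact ⟨fun h => (hfar z hz).1 h.symm, fun h => (hfar z hz).2 h.symm⟩
    · obtain rfl : z = x := hz
      exact hfar y hy
    · exact absurd rfl hij
  · rintro y (rfl | hy)
    · exact Set.mem_iUnion.2 ⟨false, rfl⟩
    · exact Set.mem_iUnion.2 ⟨true, hy⟩

/-- The graph of `f` on `Z`. -/
def graphOn (f : A → B) (Z : Finset A) : Set (A × B) := (fun a => (a, f a)) '' (Z : Set A)

theorem graphOn_update [DecidableEq A] (f : A → B) {Z : Finset A} {z : A} (hz : z ∉ Z) (y : B) :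
    graphOn (Function.update f z y) (insert z Z) = insert (z, y) (graphOn f Z) := by
  ext ⟨a, b⟩
  simp only [graphOn, Finset.coe_insert, Set.image_insert_eq, Function.update_self,
    Set.mem_insert_iff, Set.mem_image, Finset.mem_coe]
  refine or_congr Iff.rfl (exists_congr fun x => and_congr_right fun hx => ?_)
  have hne : x ≠ z := fun h => hz (h ▸ hx)
  rw [Function.update_of_ne hne]

/-- A finite set of elements near `p` can be added at once. -/
theorem LocalSim.exists_extend_near [Nonempty B] {k s : ℕ} {p : Set (A × B)} (Z : Finset A)
    (h : LocalSim P (k + s * Z.card) p) (hZ : ∀ z ∈ Z, ∃ x ∈ p, Near L s x.1 z) :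
    ∃ f : A → B, LocalSim P k (p ∪ graphOn f Z) := by
  classical
  induction Z using Finset.induction_on generalizing p with
  | empty =>
    exact ⟨fun _ => Classical.arbitrary B, by simpa [graphOn] using h⟩
  | insert z Z hz ih =>
    obtain ⟨x, hx, hn⟩ := hZ z (Finset.mem_insert_self _ _)
    rw [Finset.card_insert_of_notMem hz, mul_add, mul_one, ← add_assoc] at h
    obtain ⟨y, -, hs⟩ := h.exists_move hx hn
    obtain ⟨f, hf⟩ := ih hs fun z' hz' => by
      obtain ⟨x, hx, hn⟩ := hZ z' (Finset.mem_insert_of_mem hz')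
      exact ⟨x, Or.inr hx, hn⟩
    refine ⟨Function.update f z y, ?_⟩
    rw [graphOn_update f hz, Set.union_insert, ← Set.insert_union]
    exact hf

/-- Every set of at most `N` further elements can be added on the left. -/
def Extends (P : Signs L) (k N : ℕ) (p : Set (A × B)) : Prop :=
  ∀ Z : Finset A, Z.card ≤ N → ∃ f : A → B, LocalSim P k (p ∪ graphOn f Z)

theorem Extends.mono {k k' N N' : ℕ} (hk : k ≤ k') (hN : N ≤ N') {p : Set (A × B)}
    (h : Extends P k' N' p) : Extends P k N p := fun Z hZ =>
  (h Z (hZ.trans hN)).imp fun _ hf => hf.mono hk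

/-- Every set of at most `N` further elements can be added on each side. -/
def GlobalSim (P : Signs L) (k N : ℕ) (p : Set (A × B)) : Prop :=
  Extends P k N p ∧ Extends P.dual k N (Prod.swap ⁻¹' p)

theorem GlobalSim.mono {k k' N N' : ℕ} (hk : k ≤ k') (hN : N ≤ N') {p : Set (A × B)}
    (h : GlobalSim P k' N' p) : GlobalSim P k N p :=
  ⟨h.1.mono hk hN, h.2.mono hk hN⟩

theorem GlobalSim.swap {k N : ℕ} {p : Set (A × B)} (h : GlobalSim P k N p) :
    GlobalSim P.dual k N (Prod.swap ⁻¹' p) := by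
  refine ⟨h.2, ?_⟩
  rw [Signs.dual_dual]
  exact h.1

theorem GlobalSim.localSim {k N : ℕ} {p : Set (A × B)} (h : GlobalSim P k N p) :
    LocalSim P k p := by
  obtain ⟨f, hf⟩ := h.1 ∅ (by simp)
  exact hf.subset Set.subset_union_left

end Sim

/-! ### Adding elements with scattered counterparts -/

section Scattered

variable {A B : Type w} [L.Structure A] [L.Structure B]

/-- The values of `v` have pairwise distance greater than `s`. -/
def IsScattered (L : FirstOrder.Language.{u, v}) {M : Type w} [L.Structure M] {ι : Type*} (s : ℕ)
    (v : ι → M) : Prop :=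
  ∀ i j, i ≠ j → ¬ Near L s (v i) (v j)

theorem IsScattered.mono {ι : Type*} {s t : ℕ} (hst : s ≤ t) {v : ι → A}
    (h : IsScattered L t v) : IsScattered L s v :=
  fun i j hij hn => h i j hij (hn.mono hst)

/-- The number of rounds that suffices to add `j` elements one after the other and to have `k`
rounds left. -/
def level (k : ℕ) : ℕ → ℕ
  | 0 => k
  | j + 1 => 3 * level k j + 1

theorem level_mono (k : ℕ) : Monotone (level k) :=
  monotone_nat_of_le_succ fun j => by rw [level]; omega

/-- A finite set of elements that have many scattered counterparts can be added at once. -/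
theorem LocalSim.exists_extend_scattered [Nonempty B] {P : Signs L} {k K M : ℕ} (Z : Finset A)
    (hK : level k Z.card ≤ K) {T : Set (A × B)} (hT : LocalSim P (level k Z.card) T)
    (hM : T.encard + Z.card ≤ M)
    (hZ : ∀ z ∈ Z, ∃ v : Fin M → B, IsScattered L (4 * K + 2) v ∧ ∀ i, LocalSim P K {(z, v i)}) :
    ∃ f : A → B, LocalSim P k (T ∪ graphOn f Z) := by
  classical
  induction Z using Finset.induction_on generalizing T with
  | empty =>
    exact ⟨fun _ => Classical.arbitrary B, by simpa [graphOn, level] using hT⟩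
  | insert z Z hz ih =>
    rw [Finset.card_insert_of_notMem hz] at hK hT hM
    have hlev : level k (Z.card + 1) = 3 * level k Z.card + 1 := rfl
    -- Walking to a near `z` costs `2 * level + 1` rounds and leaves `level`; beyond this distance
    -- `insert_far` applies.
    obtain ⟨y, hy⟩ : ∃ y, LocalSim P (level k Z.card) (insert (z, y) T) := by
      by_cases hnear : ∃ x ∈ T, Near L (2 * level k Z.card + 1) x.1 z
      · obtain ⟨x, hx, hn⟩ := hnear
        obtain ⟨y, -, hs⟩ := LocalSim.exists_move (k := level k Z.card)
          (hT.mono (by omega)) hx hn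
        exact ⟨y, hs⟩
      · push Not at hnear
        obtain ⟨v, hv, hvs⟩ := hZ z (Finset.mem_insert_self _ _)
        obtain ⟨i, hi⟩ : ∃ i, ∀ x ∈ T, ¬ Near L (2 * level k Z.card + 1) x.2 (v i) := by
          -- Pigeonhole: two entries of `v` near the same element of `T` would be at distance at
          -- most `2 * (2K+1) = 4K+2`. So `T` would have at least `M` elements, too many by `hM`.
          by_contra! hcon
          choose x hx hxn using hcon
          have hinj : Function.Injective (fun i => (⟨x i, hx i⟩ : T)) := by
            intro i j hij
            by_contra hne
            have hxx : x i = x j := congrArg Subtype.val hij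
            refine hv i j hne (Near.mono ?_ ((hxn i).symm.trans (hxx ▸ hxn j)))
            omega
          have hcard := ENat.card_le_card_of_injective hinj
          rw [ENat.card_eq_coe_fintype_card, Fintype.card_fin] at hcard
          change (M : ℕ∞) ≤ T.encard at hcard
          have hle : T.encard + ((Z.card + 1 : ℕ) : ℕ∞) ≤ T.encard := hM.trans hcard
          have hfin : T.encard ≠ ⊤ := by
            intro h
            rw [h] at hM
            simp at hM
          lift T.encard to ℕ using hfin with c
          norm_cast at hle
          omega
        exact ⟨v i, (hT.mono (by omega)).insert_far ((hvs i).mono (by omega))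
          fun x hx => ⟨hnear x hx, hi x hx⟩⟩
    obtain ⟨f, hf⟩ := ih (by omega) hy
      (by
        refine le_trans ?_ hM
        push_cast
        rw [add_comm (Z.card : ℕ∞) 1, ← add_assoc]
        gcongr
        exact Set.encard_insert_le _ _)
      fun z' hz' => hZ z' (Finset.mem_insert_of_mem hz')
    refine ⟨Function.update f z y, ?_⟩
    rw [graphOn_update f hz, Set.union_insert, ← Set.insert_union]
    exact hf

theorem encard_graphOn_le (f : A → B) (Z : Finset A) : (graphOn f Z).encard ≤ Z.card := by
  rw [graphOn]
  exact (Set.encard_image_le _ _).trans (by rw [Set.encard_coe_eq_coe_finsetCard])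

/-- If every element of `A` is near `q` or has many scattered counterparts in `B`, then finite
sets of elements can be added. -/
theorem extends_of_near_or_scattered [Nonempty B] {P : Signs L} {k N n r : ℕ}
    {q T : Set (A × B)} (hq : LocalSim P (level k N + r * N) q) (hT : T ⊆ q) (hn : T.encard ≤ n)
    (h : ∀ z : A, (∃ x ∈ q, Near L r x.1 z) ∨ ∃ v : Fin (n + N) → B,
      IsScattered L (4 * level k N + 2) v ∧ ∀ i, LocalSim P (level k N) {(z, v i)}) :
    Extends P k N T := by
  classical
  intro Z hZ
  have hcard := Z.card_filter_add_card_filter_not (fun z => ∃ x ∈ q, Near L r x.1 z)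
  set Z₁ := Z.filter fun z => ∃ x ∈ q, Near L r x.1 z with hZ₁
  set Z₂ := Z.filter fun z => ¬ ∃ x ∈ q, Near L r x.1 z with hZ₂
  obtain ⟨f₁, hf₁⟩ := LocalSim.exists_extend_near (k := level k N) (s := r) Z₁
    (hq.mono (by gcongr; omega)) fun z hz => (Finset.mem_filter.1 hz).2
  have hle : level k Z₂.card ≤ level k N := level_mono k (by omega)
  -- From here on `q` is replaced by `T`: the size of `q` is not bounded, and only `n + N`
  -- counterparts are available.
  obtain ⟨f₂, hf₂⟩ := LocalSim.exists_extend_scattered (k := k) (K := level k N) (M := n + N) Z₂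
    hle (T := T ∪ graphOn f₁ Z₁)
    ((hf₁.mono hle).subset (Set.union_subset_union_left _ hT))
    (by
      calc (T ∪ graphOn f₁ Z₁).encard + Z₂.card ≤ (n + Z₁.card) + Z₂.card := by
            gcongr
            exact (Set.encard_union_le _ _).trans (add_le_add hn (encard_graphOn_le _ _))
        _ ≤ ((n + N : ℕ) : ℕ∞) := by
            norm_cast
            omega)
    fun z hz => (h z).resolve_left (Finset.mem_filter.1 hz).2
  refine ⟨fun z => if ∃ x ∈ q, Near L r x.1 z then f₁ z else f₂ z, hf₂.subset ?_⟩
  rintro x (hx | ⟨z, hz, rfl⟩)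
  · exact Or.inl (Or.inl hx)
  · by_cases hzq : ∃ x ∈ q, Near L r x.1 z
    · refine Or.inl (Or.inr ⟨z, Finset.mem_filter.2 ⟨hz, hzq⟩, ?_⟩)
      simp only [if_pos hzq]
    · refine Or.inr ⟨z, Finset.mem_filter.2 ⟨hz, hzq⟩, ?_⟩
      simp only [if_neg hzq]

end Scattered

/-! ### Choice of scales -/

/-- Cut the sequence into blocks of length `Q`. The sum over `I` drops in each block that violates
the claim, and it starts at `|I| * M` or below. -/
theorem exists_plateau {I : Type*} [Fintype I] (c : ℕ → I → ℕ) (hc : ∀ i, Antitone fun j => c j i)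
    (M : ℕ) (hM : ∀ j i, c j i ≤ M) (Q : ℕ) :
    ∃ j ≤ Fintype.card I * M * Q, ∀ i, c (j + Q) i = c j i := by
  by_contra! hcon
  have hS : ∀ l ≤ Fintype.card I * M + 1, ∑ i, c (l * Q) i + l ≤ ∑ i, c 0 i := by
    intro l
    induction l with
    | zero => intro _; simp
    | succ l ih =>
      intro hl
      have h1 := ih (by omega)
      obtain ⟨i, hi⟩ := hcon (l * Q) (Nat.mul_le_mul_right _ (by omega))
      have : ∑ i, c ((l + 1) * Q) i < ∑ i, c (l * Q) i := by
        rw [add_mul, one_mul]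
        refine Finset.sum_lt_sum (fun i _ => hc i (Nat.le_add_right _ _)) ⟨i, Finset.mem_univ _, ?_⟩
        exact lt_of_le_of_ne (hc i (Nat.le_add_right _ _)) hi
      omega
  have h1 := hS _ le_rfl
  have h2 : ∑ i, c 0 i ≤ Fintype.card I * M := by
    refine (Finset.sum_le_card_nsmul _ _ M fun i _ => hM 0 i).trans ?_
    simp
  omega

theorem exists_stable {I : Type*} [Fintype I] (X : ℕ → I → Prop)
    (hX : ∀ i j, X j i → X (j + 1) i) {m : ℕ} (hm : Fintype.card I ≤ m) :
    ∃ j ≤ m, ∀ i, X (j + 1) i → X j i := by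
  classical
  obtain ⟨j, hj, h⟩ := exists_plateau (fun j i => if X j i then 0 else 1)
    (fun i => antitone_nat_of_succ_le fun j => by
      by_cases h : X j i
      · simp [h, hX i j h]
      · simp only [h, if_false]; split_ifs <;> omega) 1 (fun j i => by split_ifs <;> omega) 1
  refine ⟨j, by omega, fun i hi => ?_⟩
  have := h i
  by_contra hn
  simp [hi, hn] at this

/-! ### Matchings -/

/-- Given a partial injection `f` on `X₀` and a partial injection `g` on `Y₀` in the opposite
direction, there is a matching that covers `X₀` and `Y₀` and uses only pairs of `f` and `g`. -/
theorem exists_matching {X Y : Type*} {X₀ : Set X} {Y₀ : Set Y} {f : X → Y} {g : Y → X}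
    (hf : Set.InjOn f X₀) (hg : Set.InjOn g Y₀) :
    ∃ H : Set (X × Y), (∀ x ∈ H, (x.1 ∈ X₀ ∧ x.2 = f x.1) ∨ (x.2 ∈ Y₀ ∧ x.1 = g x.2)) ∧
      (∀ x ∈ H, ∀ y ∈ H, x.1 = y.1 ↔ x.2 = y.2) ∧
      (∀ x ∈ X₀, ∃ y, (x, y) ∈ H) ∧ ∀ y ∈ Y₀, ∃ x, (x, y) ∈ H := by
  classical
  -- An element outside the domain is sent to a private dummy, and dummies are shifted. This makes
  -- both maps total injections, so that Schröder–Bernstein applies.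
  let F : X ⊕ ℕ × (X ⊕ Y) → Y ⊕ ℕ × (X ⊕ Y) := Sum.elim
    (fun x => if x ∈ X₀ then Sum.inl (f x) else Sum.inr (0, Sum.inl x))
    (fun d => Sum.inr (d.1 + 1, d.2))
  let G : Y ⊕ ℕ × (X ⊕ Y) → X ⊕ ℕ × (X ⊕ Y) := Sum.elim
    (fun y => if y ∈ Y₀ then Sum.inl (g y) else Sum.inr (0, Sum.inr y))
    (fun d => Sum.inr (d.1 + 1, d.2))
  have hF : Function.Injective F := by
    rintro (x | ⟨d, e⟩) (x' | ⟨d', e'⟩) h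
    · by_cases hx : x ∈ X₀ <;> by_cases hx' : x' ∈ X₀ <;> simp [F, hx, hx'] at h
      · rw [hf hx hx' h]
      · rw [h]
    · by_cases hx : x ∈ X₀ <;> simp [F, hx] at h
    · by_cases hx : x' ∈ X₀ <;> simp [F, hx] at h
    · simp [F] at h
      simp [h]
  have hG : Function.Injective G := by
    rintro (x | ⟨d, e⟩) (x' | ⟨d', e'⟩) h
    · by_cases hx : x ∈ Y₀ <;> by_cases hx' : x' ∈ Y₀ <;> simp [G, hx, hx'] at h
      · rw [hg hx hx' h]
      · rw [h]
    · by_cases hx : x ∈ Y₀ <;> simp [G, hx] at h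
    · by_cases hx : x' ∈ Y₀ <;> simp [G, hx] at h
    · simp [G] at h
      simp [h]
  -- The relation keeps the bijection from matching elements of `X₀` or `Y₀` with dummies.
  let R : X ⊕ ℕ × (X ⊕ Y) → Y ⊕ ℕ × (X ⊕ Y) → Prop := fun a b => match a, b with
    | Sum.inl x, Sum.inl y => (x ∈ X₀ ∧ y = f x) ∨ (y ∈ Y₀ ∧ x = g y)
    | Sum.inl x, Sum.inr _ => x ∉ X₀
    | Sum.inr _, Sum.inl y => y ∉ Y₀
    | Sum.inr _, Sum.inr _ => True
  obtain ⟨h, hbij, hR⟩ := Function.Embedding.schroeder_bernstein_of_rel hF hG R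
    (by
      rintro (x | d)
      · by_cases hx : x ∈ X₀ <;> simp [F, R, hx]
      · simp [F, R])
    (by
      rintro (x | d)
      · by_cases hx : x ∈ Y₀ <;> simp [G, R, hx]
      · simp [G, R])
  refine ⟨{x | h (Sum.inl x.1) = Sum.inl x.2}, ?_, ?_, ?_, ?_⟩
  · rintro ⟨x, y⟩ hxy
    have := hR (Sum.inl x)
    rw [show h (Sum.inl x) = Sum.inl y from hxy] at this
    exact this
  · rintro ⟨x, y⟩ hxy ⟨x', y'⟩ hxy'
    simp only [Set.mem_ofPred_eq] at hxy hxy' ⊢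
    constructor
    · rintro rfl
      exact Sum.inl_injective (hxy.symm.trans hxy')
    · rintro rfl
      exact Sum.inl_injective (hbij.1 (hxy.trans hxy'.symm))
  · intro x hx
    have := hR (Sum.inl x)
    rcases hh : h (Sum.inl x) with y | d
    · exact ⟨y, hh⟩
    · rw [hh] at this
      exact absurd hx this
  · intro y hy
    obtain ⟨x | d, hx⟩ := hbij.2 (Sum.inl y)
    · exact ⟨x, hx⟩
    · have := hR (Sum.inr d)
      rw [hx] at this
      exact absurd hy this

/-- A version of `exists_matching` for elements up to equivalence. -/
theorem exists_matching_setoid {X Y : Type*} (r : Setoid X) (s : Setoid Y) {X₀ : Set X}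
    {Y₀ : Set Y} {f : X → Y} {g : Y → X} (hf : ∀ x ∈ X₀, ∀ x' ∈ X₀, r x x' ↔ s (f x) (f x'))
    (hg : ∀ y ∈ Y₀, ∀ y' ∈ Y₀, s y y' ↔ r (g y) (g y')) :
    ∃ H : Set (X × Y), (∀ x ∈ H, (x.1 ∈ X₀ ∧ x.2 = f x.1) ∨ (x.2 ∈ Y₀ ∧ x.1 = g x.2)) ∧
      (∀ x ∈ H, ∀ y ∈ H, x ≠ y → ¬ r x.1 y.1 ∧ ¬ s x.2 y.2) ∧
      (∀ x ∈ X₀, ∃ y ∈ H, r y.1 x) ∧ ∀ y ∈ Y₀, ∃ x ∈ H, s x.2 y := by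
  classical
  let mX : X → Quotient r := Quotient.mk r
  let mY : Y → Quotient s := Quotient.mk s
  have hmX : ∀ x x', mX x = mX x' ↔ r x x' := fun x x' => Quotient.eq
  have hmY : ∀ x x', mY x = mY x' ↔ s x x' := fun x x' => Quotient.eq
  have hX : ∀ a, ∃ x, a ∈ mX '' X₀ → x ∈ X₀ ∧ mX x = a := fun a => by
    by_cases ha : a ∈ mX '' X₀
    · obtain ⟨x, hx⟩ := ha
      exact ⟨x, fun _ => hx⟩
    · exact ⟨a.out, fun h => absurd h ha⟩
  have hY : ∀ b, ∃ y, b ∈ mY '' Y₀ → y ∈ Y₀ ∧ mY y = b := fun b => by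
    by_cases hb : b ∈ mY '' Y₀
    · obtain ⟨y, hy⟩ := hb
      exact ⟨y, fun _ => hy⟩
    · exact ⟨b.out, fun h => absurd h hb⟩
  choose x hx' using hX
  choose y hy' using hY
  have hx := fun a ha => (hx' a ha).1
  have hxm := fun a ha => (hx' a ha).2
  have hy := fun a ha => (hy' a ha).1
  have hym := fun a ha => (hy' a ha).2
  obtain ⟨H, h1, h2, h3, h4⟩ := exists_matching (X₀ := mX '' X₀) (Y₀ := mY '' Y₀)
    (f := fun a => mY (f (x a))) (g := fun b => mX (g (y b)))
    (fun a ha a' ha' haa => by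
      have := (hf _ (hx a ha) _ (hx a' ha')).2 ((hmY _ _).1 haa)
      rw [← hxm a ha, ← hxm a' ha']
      exact (hmX _ _).2 this)
    (fun a ha a' ha' haa => by
      have := (hg _ (hy a ha) _ (hy a' ha')).2 ((hmX _ _).1 haa)
      rw [← hym a ha, ← hym a' ha']
      exact (hmY _ _).2 this)
  have h5 : ∀ a, ∃ z : X × Y, a ∈ H → mX z.1 = a.1 ∧ mY z.2 = a.2 ∧
      ((z.1 ∈ X₀ ∧ z.2 = f z.1) ∨ (z.2 ∈ Y₀ ∧ z.1 = g z.2)) := by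
    intro a
    by_cases ha : a ∈ H
    swap
    · exact ⟨(a.1.out, a.2.out), fun h => absurd h ha⟩
    rcases h1 a ha with ⟨h, h'⟩ | ⟨h, h'⟩
    · exact ⟨(x a.1, f (x a.1)), fun _ => ⟨hxm _ h, h'.symm, Or.inl ⟨hx _ h, rfl⟩⟩⟩
    · exact ⟨(g (y a.2), y a.2), fun _ => ⟨h'.symm, hym _ h, Or.inr ⟨hy _ h, rfl⟩⟩⟩
  choose z hz using h5
  have hz1 := fun a ha => (hz a ha).1
  have hz2 := fun a ha => (hz a ha).2.1
  have hz3 := fun a ha => (hz a ha).2.2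
  refine ⟨z '' H, ?_, ?_, ?_, ?_⟩
  · rintro _ ⟨a, ha, rfl⟩
    exact hz3 a ha
  · rintro _ ⟨a, ha, rfl⟩ _ ⟨b, hb, rfl⟩ hab
    rw [← hmX, ← hmY, hz1 a ha, hz1 b hb, hz2 a ha, hz2 b hb]
    have hab' : a ≠ b := fun h => hab (h ▸ rfl)
    have := h2 a ha b hb
    refine ⟨fun h => hab' (Prod.ext h (this.1 h)), fun h => hab' (Prod.ext (this.2 h) h)⟩
  · intro u hu
    obtain ⟨b, hb⟩ := h3 (mX u) ⟨u, hu, rfl⟩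
    exact ⟨_, ⟨_, hb, rfl⟩, (hmX _ _).1 (hz1 _ hb)⟩
  · intro u hu
    obtain ⟨b, hb⟩ := h4 (mY u) ⟨u, hu, rfl⟩
    exact ⟨_, ⟨_, hb, rfl⟩, (hmY _ _).1 (hz2 _ hb)⟩

/-! ### Scattered sets: representatives and transversals -/

section Metric

variable {A : Type w} [L.Structure A]

/-- The largest number of scattered elements with colour `t`, capped at `M`. -/
noncomputable def scatterNumber (L : FirstOrder.Language.{u, v}) {A : Type w} [L.Structure A]
    {Γ : Type*} (col : A → Γ) (M s : ℕ) (t : Γ) : ℕ :=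
  @Nat.findGreatest (fun m => ∃ v : Fin m → A, IsScattered L s v ∧ ∀ i, col (v i) = t)
    (fun _ => Classical.propDecidable _) M

theorem scatterNumber_le {Γ : Type*} (col : A → Γ) (M s : ℕ) (t : Γ) :
    scatterNumber L col M s t ≤ M :=
  @Nat.findGreatest_le _ (fun _ => Classical.propDecidable _) _

theorem scatterNumber_anti {Γ : Type*} (col : A → Γ) (M : ℕ) (t : Γ) :
    Antitone fun s => scatterNumber L col M s t := by
  intro s s' hs
  refine @Nat.findGreatest_mono_left _ _ (fun _ => Classical.propDecidable _)
    (fun _ => Classical.propDecidable _) (fun m => ?_) M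
  rintro ⟨v, hv, hc⟩
  exact ⟨v, hv.mono hs, hc⟩

/-- If the scattered elements of each colour are counted alike at two scales, then finitely many
elements represent all elements that are not of a frequent colour. -/
theorem exists_representatives {Γ : Type*} [Fintype Γ] (col : A → Γ) {M s s' : ℕ} (hs : s ≤ s')
    (h : ∀ t, scatterNumber L col M s' t = scatterNumber L col M s t) :
    ∃ A₀ : Finset A, A₀.card ≤ Fintype.card Γ * M ∧
      ∀ z : A, (∃ u ∈ A₀, Near L s u z) ∨
        ∃ v : Fin M → A, (∀ i, v i ∈ A₀) ∧ IsScattered L s' v ∧ ∀ i, col (v i) = col z := by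
  classical
  have hex : ∀ t, ∃ v : Fin (scatterNumber L col M s' t) → A,
      IsScattered L s' v ∧ ∀ i, col (v i) = t := fun t =>
    @Nat.findGreatest_spec 0
      (fun m => ∃ v : Fin m → A, IsScattered L s' v ∧ ∀ i, col (v i) = t) 
      (fun _ => Classical.propDecidable _) _
      (Nat.zero_le M)
      ⟨Fin.elim0, fun i => i.elim0, fun i => i.elim0⟩
  choose v hv hcol using hex
  refine ⟨Finset.univ.biUnion fun t => Finset.univ.image (v t), ?_, fun z => ?_⟩
  · refine Finset.card_biUnion_le.trans ((Finset.sum_le_card_nsmul _ _ M fun t _ => ?_).trans ?_)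
    · refine Finset.card_image_le.trans ?_
      simpa using scatterNumber_le col M s' t
    · simp
  · have hmem : ∀ t i, v t i ∈ Finset.univ.biUnion fun t => Finset.univ.image (v t) :=
      fun t i => Finset.mem_biUnion.2
        ⟨t, Finset.mem_univ _, Finset.mem_image.2 ⟨i, Finset.mem_univ _, rfl⟩⟩
    rcases (scatterNumber_le (L := L) col M s' (col z)).eq_or_lt with hM | hM
    · refine Or.inr ⟨fun i => v (col z) (Fin.cast hM.symm i), fun i => hmem _ _,
        fun i j hij => hv _ _ _ fun h => hij ?_, fun i => hcol _ _⟩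
      simpa using h
    · refine Or.inl ?_
      by_contra! hcon
      have hfar : ∀ i, ¬ Near L s (v (col z) i) z := fun i => hcon _ (hmem _ _)
      -- A maximal family at scale `s'` is also scattered at scale `s`; with a far `z` it would
      -- exceed the equal count there.
      have : scatterNumber L col M s' (col z) + 1 ≤ scatterNumber L col M s (col z) := by
        refine @Nat.le_findGreatest _ _ (fun _ => Classical.propDecidable _) _ hM ⟨Fin.snoc (v (col z)) z, ?_, ?_⟩
        · intro i j
          refine Fin.lastCases ?_ (fun i => ?_) i <;> refine Fin.lastCases ?_ (fun j => ?_) j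
          · intro hij; exact absurd rfl hij
          · intro _ hn
            simp only [Fin.snoc_last, Fin.snoc_castSucc] at hn
            exact hfar j hn.symm
          · intro _ hn
            simp only [Fin.snoc_last, Fin.snoc_castSucc] at hn
            exact hfar i hn
          · intro hij hn
            simp only [Fin.snoc_castSucc] at hn
            exact hv (col z) i j (fun h => hij (h ▸ rfl)) (hn.mono hs)
        · intro i
          refine Fin.lastCases ?_ (fun i => ?_) i
          · simp
          · simpa using hcol (col z) i
      rw [h] at this
      omega

/-- Hall's marriage theorem for scattered transversals. -/
theorem exists_scattered_transversal {ι : Type*} [Fintype ι] (S : ι → Set A) (D : ℕ) {m : ℕ}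
    (hm : Fintype.card ι ≤ m)
    (h : ∀ I : Finset ι, ∃ w : Fin I.card → A,
      IsScattered L (D * 2 ^ ((2 ^ m * m) ^ 2 + 1)) w ∧ ∀ x, ∃ i ∈ I, w x ∈ S i) :
    ∃ v : ι → A, (∀ i, v i ∈ S i) ∧ IsScattered L D v := by
  classical
  choose w hw hwS using h
  let W : Finset A := Finset.univ.biUnion fun I => Finset.univ.image (w I)
  have hmem : ∀ I x, w I x ∈ W := fun I x => Finset.mem_biUnion.2
    ⟨I, Finset.mem_univ _, Finset.mem_image.2 ⟨x, Finset.mem_univ _, rfl⟩⟩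
  have hcard : W.card ≤ 2 ^ m * m := by
    refine Finset.card_biUnion_le.trans ((Finset.sum_le_card_nsmul _ _ m fun I _ => ?_).trans ?_)
    · refine Finset.card_image_le.trans ?_
      rw [Finset.card_univ, Fintype.card_fin]
      exact (Finset.card_le_univ I).trans hm
    · rw [smul_eq_mul, Finset.card_univ, Fintype.card_finset]
      gcongr
      omega
  -- At a scale where doubling adds no near pairs in `W`, nearness is an equivalence relation on
  -- `W`. Hall's theorem is applied to its classes: the points of `w I` lie in different ones, being
  -- far apart.
  obtain ⟨j, hj, hst⟩ := exists_stable (I := W × W)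
    (fun j x => Near L (D * 2 ^ j) x.1.1 x.2.1) (fun x j hx => hx.mono (by gcongr <;> omega))
    (m := (2 ^ m * m) ^ 2) (by
      rw [Fintype.card_prod, Fintype.card_coe, ← sq]
      gcongr)
  have hst' : ∀ x ∈ W, ∀ y ∈ W, Near L (D * 2 ^ (j + 1)) x y → Near L (D * 2 ^ j) x y :=
    fun x hx y hy hn => hst (⟨x, hx⟩, ⟨y, hy⟩) hn
  have htr : ∀ x ∈ W, ∀ y ∈ W, ∀ z ∈ W, Near L (D * 2 ^ j) x y → Near L (D * 2 ^ j) y z →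
      Near L (D * 2 ^ j) x z := fun x hx y hy z hz hxy hyz =>
    hst' x hx z hz ((hxy.trans hyz).mono (by rw [pow_succ, ← mul_assoc]; omega))
  let cls : A → Finset A := fun x => W.filter fun y => Near L (D * 2 ^ j) x y
  have hcls : ∀ x ∈ W, ∀ y ∈ W, cls x = cls y ↔ Near L (D * 2 ^ j) x y := by
    intro x hx y hy
    constructor
    · intro hxy
      have : y ∈ cls x := hxy ▸ Finset.mem_filter.2 ⟨hy, Near.refl _ _⟩
      exact (Finset.mem_filter.1 this).2
    · intro hn
      refine Finset.filter_congr fun z hz => ⟨fun h => ?_, fun h => ?_⟩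
      · exact htr y hy x hx z hz hn.symm h
      · exact htr x hx y hy z hz hn h
  obtain ⟨e, he, het⟩ := (Finset.all_card_le_biUnion_card_iff_exists_injective
    (fun i => (W.filter fun y => y ∈ S i).image cls)).1 (by
      intro I
      have := Finset.card_le_card_of_injOn (s := (Finset.univ : Finset (Fin I.card)))
        (t := I.biUnion fun i => (W.filter fun y => y ∈ S i).image cls) (fun x => cls (w I x))
        (by
          intro x _
          obtain ⟨i, hi, hx⟩ := hwS I x
          exact Finset.mem_coe.2 (Finset.mem_biUnion.2 ⟨i, hi, Finset.mem_image.2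
            ⟨_, Finset.mem_filter.2 ⟨hmem _ _, hx⟩, rfl⟩⟩))
        (by
          intro x _ y _ hxy
          by_contra hne
          refine hw I x y hne (((hcls _ (hmem _ _) _ (hmem _ _)).1 hxy).mono ?_)
          gcongr <;> omega)
      simpa using this)
  have hv : ∀ i, ∃ v ∈ W, v ∈ S i ∧ cls v = e i := by
    intro i
    obtain ⟨v, hv, hve⟩ := Finset.mem_image.1 (het i)
    exact ⟨v, (Finset.mem_filter.1 hv).1, (Finset.mem_filter.1 hv).2, hve⟩
  choose v hvW hvS hve using hv
  refine ⟨v, hvS, fun i i' hii' hn => hii' (he ?_)⟩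
  rw [← hve, ← hve, hcls _ (hvW _) _ (hvW _)]
  exact hn.mono (Nat.le_mul_of_pos_right _ (by positivity))

end Metric

/-! ### Answering a move in the global game -/

section Step

variable {A B : Type w} [L.Structure A] [L.Structure B]

/-- The pairs of corresponding entries of two tuples. -/
def pairs {A B : Type w} {n : ℕ} (a : Fin n → A) (b : Fin n → B) : Set (A × B) :=
  Set.range fun i => (a i, b i)

theorem swap_preimage_pairs {n : ℕ} (a : Fin n → A) (b : Fin n → B) :
    Prod.swap ⁻¹' pairs a b = pairs b a := by
  ext ⟨x, y⟩
  simp [pairs, and_comm]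

theorem pairs_snoc {n : ℕ} (a : Fin n → A) (b : Fin n → B) (c : A) (d : B) :
    pairs (Fin.snoc a c : Fin (n + 1) → A) (Fin.snoc b d : Fin (n + 1) → B) =
      insert (c, d) (pairs a b) := by
  ext x
  constructor
  · rintro ⟨i, rfl⟩
    refine Fin.lastCases ?_ (fun i => ?_) i
    · simp
    · simp only [Fin.snoc_castSucc]
      exact Or.inr ⟨i, rfl⟩
  · rintro (rfl | ⟨i, rfl⟩)
    · exact ⟨Fin.last n, by simp⟩
    · exact ⟨i.castSucc, by simp⟩

theorem encard_pairs_le {n : ℕ} (a : Fin n → A) (b : Fin n → B) : (pairs a b).encard ≤ n := by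
  rw [pairs, ← Set.image_univ]
  refine (Set.encard_image_le _ _).trans ?_
  simp [Set.encard_univ]

/-- Two partial simulations in opposite directions are combined into one that covers both
of their domains, up to the distance `r`. -/
theorem exists_common_simulation {P : Signs L} {k n r R : ℕ} {a : Fin n → A} {b : Fin n → B}
    [DecidableEq A] [DecidableEq B] {A₀ : Finset A} {B₀ : Finset B} {f : A → B} {g : B → A}
    (hf : LocalSim P k (pairs a b ∪ graphOn f A₀))
    (hg : LocalSim P k (pairs a b ∪ Prod.swap ⁻¹' graphOn g B₀)) (hRk : R ≤ k) (hrR : 2 * r ≤ R)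
    (hA : ∀ x ∈ A₀ ∪ B₀.image g, ∀ y ∈ A₀ ∪ B₀.image g, Near L R x y → Near L r x y)
    (haA : ∀ i, ∀ y ∈ A₀ ∪ B₀.image g, Near L R (a i) y → Near L r (a i) y)
    (hB : ∀ x ∈ B₀ ∪ A₀.image f, ∀ y ∈ B₀ ∪ A₀.image f, Near L R x y → Near L r x y)
    (hbB : ∀ i, ∀ y ∈ B₀ ∪ A₀.image f, Near L R (b i) y → Near L r (b i) y) :
    ∃ q : Set (A × B), pairs a b ⊆ q ∧ (∀ K, 2 * K + 1 ≤ R → LocalSim P K q) ∧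
      (∀ x ∈ A₀, ∃ y ∈ q, Near L r y.1 x) ∧ ∀ x ∈ B₀, ∃ y ∈ q, Near L r y.2 x := by
  -- Elements within `R` of the given tuples are within `r` of them by the gap, hence already
  -- covered by `pairs a b`. Only the others are matched, cluster by cluster.
  set SA : Set A := {x | x ∈ A₀ ∪ B₀.image g ∧ ∀ i, ¬ Near L R (a i) x} with hSA
  set SB : Set B := {x | x ∈ B₀ ∪ A₀.image f ∧ ∀ i, ¬ Near L R (b i) x} with hSB
  let rA : Setoid A :=
    { r := fun x y => x = y ∨ (x ∈ SA ∧ y ∈ SA ∧ Near L r x y)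
      iseqv := ⟨fun _ => Or.inl rfl, by
          rintro x y (rfl | ⟨hx, hy, h⟩)
          exacts [Or.inl rfl, Or.inr ⟨hy, hx, h.symm⟩], by
          rintro x y z (rfl | ⟨hx, hy, h⟩) (rfl | ⟨hy', hz, h'⟩)
          · exact Or.inl rfl
          · exact Or.inr ⟨hy', hz, h'⟩
          · exact Or.inr ⟨hx, hy, h⟩
          · exact Or.inr ⟨hx, hz, hA _ hx.1 _ hz.1 ((h.trans h').mono (by omega))⟩⟩ }
  let rB : Setoid B :=
    { r := fun x y => x = y ∨ (x ∈ SB ∧ y ∈ SB ∧ Near L r x y)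
      iseqv := ⟨fun _ => Or.inl rfl, by
          rintro x y (rfl | ⟨hx, hy, h⟩)
          exacts [Or.inl rfl, Or.inr ⟨hy, hx, h.symm⟩], by
          rintro x y z (rfl | ⟨hx, hy, h⟩) (rfl | ⟨hy', hz, h'⟩)
          · exact Or.inl rfl
          · exact Or.inr ⟨hy', hz, h'⟩
          · exact Or.inr ⟨hx, hy, h⟩
          · exact Or.inr ⟨hx, hz, hB _ hx.1 _ hz.1 ((h.trans h').mono (by omega))⟩⟩ }
  have hrA : ∀ x ∈ SA, ∀ y ∈ SA, rA x y ↔ Near L r x y := fun x hx y hy =>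
    ⟨fun h => h.elim (fun h => h ▸ Near.refl _ _) fun h => h.2.2, fun h => Or.inr ⟨hx, hy, h⟩⟩
  have hrB : ∀ x ∈ SB, ∀ y ∈ SB, rB x y ↔ Near L r x y := fun x hx y hy =>
    ⟨fun h => h.elim (fun h => h ▸ Near.refl _ _) fun h => h.2.2, fun h => Or.inr ⟨hx, hy, h⟩⟩
  have hgf : ∀ x ∈ A₀, ((x, f x) : A × B) ∈ pairs a b ∪ graphOn f A₀ :=
    fun x hx => Or.inr ⟨x, hx, rfl⟩
  have hgg : ∀ x ∈ B₀, ((g x, x) : A × B) ∈ pairs a b ∪ Prod.swap ⁻¹' graphOn g B₀ :=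
    fun x hx => Or.inr ⟨x, hx, rfl⟩
  have hfS : ∀ x ∈ A₀, x ∈ SA → f x ∈ SB := fun x hx hxS =>
    ⟨Finset.mem_union_right _ (Finset.mem_image_of_mem _ hx), fun i hn =>
      hxS.2 i ((hf.near_iff hRk (x := (a i, b i)) (Or.inl ⟨i, rfl⟩) (hgf x hx)).2 hn)⟩
  have hgS : ∀ x ∈ B₀, x ∈ SB → g x ∈ SA := fun x hx hxS =>
    ⟨Finset.mem_union_right _ (Finset.mem_image_of_mem _ hx), fun i hn =>
      hxS.2 i ((hg.near_iff hRk (x := (a i, b i)) (Or.inl ⟨i, rfl⟩) (hgg x hx)).1 hn)⟩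
  obtain ⟨H, h1, h2, h3, h4⟩ := exists_matching_setoid rA rB (X₀ := {x | x ∈ A₀ ∧ x ∈ SA})
    (Y₀ := {x | x ∈ B₀ ∧ x ∈ SB}) (f := f) (g := g)
    (fun x hx y hy => by
      rw [hrA _ hx.2 _ hy.2, hrB _ (hfS _ hx.1 hx.2) _ (hfS _ hy.1 hy.2)]
      exact hf.near_iff (by omega) (hgf x hx.1) (hgf y hy.1))
    (fun x hx y hy => by
      rw [hrB _ hx.2 _ hy.2, hrA _ (hgS _ hx.1 hx.2) _ (hgS _ hy.1 hy.2)]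
      exact (hg.near_iff (by omega) (hgg x hx.1) (hgg y hy.1)).symm)
  have hH : ∀ x ∈ H, x.1 ∈ SA ∧ x.2 ∈ SB ∧ LocalSim P k {x} := by
    rintro ⟨x, y⟩ hxy
    rcases h1 _ hxy with ⟨⟨hx, hxS⟩, hy⟩ | ⟨⟨hy, hyS⟩, hx⟩
    · obtain rfl : y = f x := hy
      exact ⟨hxS, hfS _ hx hxS, hf.subset (by rintro _ rfl; exact hgf x hx)⟩
    · obtain rfl : x = g y := hx
      exact ⟨hgS _ hy hyS, hyS, hg.subset (by rintro _ rfl; exact hgg y hy)⟩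
  refine ⟨pairs a b ∪ H, Set.subset_union_left, fun K hK => ?_, ?_, ?_⟩
  · have hp : LocalSim P K (pairs a b) := (hf.subset Set.subset_union_left).mono (by omega)
    -- All parts are more than `R ≥ 2K+1` apart: matched pairs lie in different clusters, and no
    -- cluster is near the tuples.
    refine (LocalSim.iUnion (p := fun o : Option H => o.elim (pairs a b) fun x => {x.1})
      ?_ ?_).subset ?_
    · rintro (_ | x)
      · exact hp
      · exact (hH x x.2).2.2.mono (by omega)
    · have key : ∀ x ∈ pairs a b, ∀ y ∈ H,
          ¬ Near L (2 * K + 1) x.1 y.1 ∧ ¬ Near L (2 * K + 1) x.2 y.2 := by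
        rintro _ ⟨i, rfl⟩ y hy
        exact ⟨fun h => (hH y hy).1.2 i (h.mono hK), fun h => (hH y hy).2.1.2 i (h.mono hK)⟩
      rintro (_ | s) (_ | t) hst x hx y hy
      · exact absurd rfl hst
      · obtain rfl : y = t := hy
        exact key x hx _ t.2
      · obtain rfl : x = s := hx
        have := key y hy _ s.2
        exact ⟨fun h => this.1 h.symm, fun h => this.2 h.symm⟩
      · obtain rfl : x = s := hx
        obtain rfl : y = t := hy
        have hne : s.1 ≠ t.1 := fun h => hst (congrArg some (Subtype.ext h))
        have := h2 _ s.2 _ t.2 hne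
        have hs := hH _ s.2
        have ht := hH _ t.2
        rw [hrA _ hs.1 _ ht.1, hrB _ hs.2.1 _ ht.2.1] at this
        exact ⟨fun h => this.1 (hA _ hs.1.1 _ ht.1.1 (h.mono hK)),
          fun h => this.2 (hB _ hs.2.1.1 _ ht.2.1.1 (h.mono hK))⟩
    · rintro x (hx | hx)
      · exact Set.mem_iUnion.2 ⟨none, hx⟩
      · exact Set.mem_iUnion.2 ⟨some ⟨x, hx⟩, rfl⟩
  · intro x hx
    by_cases hxS : x ∈ SA
    · obtain ⟨y, hy, hyx⟩ := h3 x ⟨hx, hxS⟩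
      exact ⟨y, Or.inr hy, (hrA _ (hH y hy).1 _ hxS).1 hyx⟩
    · have : ∃ i, Near L R (a i) x := by
        by_contra! hcon
        exact hxS ⟨Finset.mem_union_left _ hx, hcon⟩
      obtain ⟨i, hi⟩ := this
      exact ⟨(a i, b i), Or.inl ⟨i, rfl⟩, haA i x (Finset.mem_union_left _ hx) hi⟩
  · intro x hx
    by_cases hxS : x ∈ SB
    · obtain ⟨y, hy, hyx⟩ := h4 x ⟨hx, hxS⟩
      exact ⟨y, Or.inr hy, (hrB _ (hH y hy).2.1 _ hxS).1 hyx⟩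
    · have : ∃ i, Near L R (b i) x := by
        by_contra! hcon
        exact hxS ⟨Finset.mem_union_left _ hx, hcon⟩
      obtain ⟨i, hi⟩ := this
      exact ⟨(a i, b i), Or.inl ⟨i, rfl⟩, hbB i x (Finset.mem_union_left _ hx) hi⟩

/-- A fast growing sequence of distances. -/
def scale (κ N : ℕ) : ℕ → ℕ
  | 0 => 0
  -- With `r = scale κ N j`, this exceeds `2 * (κ + 2 * r * N + r) + 1`, the separation needed for
  -- the simulation `q` below, and also `2 * r` and `4 * κ + 2`.
  | j + 1 => 6 * κ + 4 * (scale κ N j * N) + 4 * scale κ N j + 3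

theorem scale_mono (κ N : ℕ) : Monotone (scale κ N) :=
  monotone_nat_of_le_succ fun j => by rw [scale]; omega

end Step

/-- A scale at which two coloured structures have as many scattered elements of every colour as at
a much larger scale. -/
theorem exists_scale_with_representatives {Γ : Type*} [Fintype Γ] {A B : Type w} [L.Structure A]
    [L.Structure B] (colA : A → Γ) (colB : B → Γ) (M Q : ℕ) {ρ : ℕ → ℕ} (hρ : Monotone ρ) :
    ∃ j ≤ (Fintype.card Γ + Fintype.card Γ) * M * Q,
      (∃ A₀ : Finset A, A₀.card ≤ Fintype.card Γ * M ∧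
        ∀ z : A, (∃ x ∈ A₀, Near L (ρ j) x z) ∨ ∃ v : Fin M → A,
          (∀ i, v i ∈ A₀) ∧ IsScattered L (ρ (j + Q)) v ∧ ∀ i, colA (v i) = colA z) ∧
      ∃ B₀ : Finset B, B₀.card ≤ Fintype.card Γ * M ∧
        ∀ z : B, (∃ x ∈ B₀, Near L (ρ j) x z) ∨ ∃ v : Fin M → B,
          (∀ i, v i ∈ B₀) ∧ IsScattered L (ρ (j + Q)) v ∧ ∀ i, colB (v i) = colB z := by
  obtain ⟨j, hj, h⟩ := exists_plateau (I := Γ ⊕ Γ)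
    (fun j => Sum.elim (fun t => scatterNumber L colA M (ρ j) t)
      fun t => scatterNumber L colB M (ρ j) t)
    (by
      rintro (t | t) j j' hjj'
      · exact scatterNumber_anti colA M t (hρ hjj')
      · exact scatterNumber_anti colB M t (hρ hjj')) M
    (by
      rintro j (t | t)
      · exact scatterNumber_le _ _ _ _
      · exact scatterNumber_le _ _ _ _) Q
  rw [Fintype.card_sum] at hj
  exact ⟨j, hj, exists_representatives colA (hρ (Nat.le_add_right _ _)) fun t => h (Sum.inl t),
    exists_representatives colB (hρ (Nat.le_add_right _ _)) fun t => h (Sum.inr t)⟩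

/-- A scale without intermediate distances in two finite sets. -/
theorem exists_gap {A B : Type w} [L.Structure A] [L.Structure B] (S : Finset A) (T : Finset B)
    {ρ : ℕ → ℕ} (hρ : Monotone ρ) {m : ℕ} (hS : S.card ≤ m) (hT : T.card ≤ m) :
    ∃ j ≤ 2 * m ^ 2, (∀ x ∈ S, ∀ y ∈ S, Near L (ρ (j + 1)) x y → Near L (ρ j) x y) ∧
      ∀ x ∈ T, ∀ y ∈ T, Near L (ρ (j + 1)) x y → Near L (ρ j) x y := by
  obtain ⟨j, hj, h⟩ := exists_stable (I := S × S ⊕ T × T)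
    (fun j => Sum.elim (fun x => Near L (ρ j) x.1.1 x.2.1) fun x => Near L (ρ j) x.1.1 x.2.1)
    (by
      rintro (x | x) j hx
      · exact Near.mono (hρ (Nat.le_succ j)) hx
      · exact Near.mono (hρ (Nat.le_succ j)) hx) (m := 2 * m ^ 2)
    (by
      rw [Fintype.card_sum, Fintype.card_prod, Fintype.card_prod, Fintype.card_coe,
        Fintype.card_coe]
      nlinarith [Nat.mul_le_mul hS hS, Nat.mul_le_mul hT hT])
  exact ⟨j, hj, fun x hx y hy hn => h (Sum.inl (⟨x, hx⟩, ⟨y, hy⟩)) hn,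
    fun x hx y hy hn => h (Sum.inr (⟨x, hx⟩, ⟨y, hy⟩)) hn⟩

/-- Duplicator can answer a move of Spoiler in the first structure. -/
theorem exists_globalSim_snoc (P : Signs L) (n N k C : ℕ)
    (hcol : ∀ (A : Type w) [L.Structure A], ∃ col : A → Fin C,
      ∀ x y, col x = col y → LocalSim P (level k N) {(x, y)}) :
    ∃ N' k', ∀ (A B : Type w) [L.Structure A] [L.Structure B] [Nonempty A] [Nonempty B]
      (a : Fin n → A) (b : Fin n → B), GlobalSim P k' N' (pairs a b) → ∀ c, ∃ d,
        GlobalSim P k N (pairs (Fin.snoc a c : Fin (n + 1) → A) (Fin.snoc b d)) := by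
  classical
  set κ := level k N with hκ
  -- `M` counts the extended tuple and `N` further elements; `m` bounds the points among which a gap
  -- is sought. The plateau has length `Q` because the gap depends on the representatives and must
  -- be found inside it afterwards.
  set M := n + 1 + N with hM
  set m := 2 * (C * M + 1) + n with hm
  set Q := 2 * m ^ 2 + 1 with hQ
  have hρ := scale_mono κ N
  set ρ := scale κ N with hρdef
  -- There are at most `C * M` representatives, and `c`; the number of rounds covers the largest
  -- scale that can occur.
  refine ⟨C * M + 1, κ + ρ ((C + C) * M * Q + Q), fun A B _ _ _ _ a b hG c => ?_⟩
  obtain ⟨colA, hcolA⟩ := hcol A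
  obtain ⟨colB, hcolB⟩ := hcol B
  obtain ⟨j₀, hj₀, ⟨A₀, hA₀, hrepA⟩, B₀, hB₀, hrepB⟩ :=
    exists_scale_with_representatives (L := L) colA colB M Q hρ
  rw [Fintype.card_fin] at hj₀ hA₀ hB₀
  have hρQ : ρ (j₀ + Q) ≤ ρ ((C + C) * M * Q + Q) := hρ (by omega)
  have hcA : (insert c A₀).card ≤ C * M + 1 := (Finset.card_insert_le _ _).trans (by omega)
  obtain ⟨f, hf⟩ := hG.1 (insert c A₀) hcA
  obtain ⟨g, hg⟩ := hG.2 B₀ (by omega)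
  have hg' : LocalSim P (κ + ρ ((C + C) * M * Q + Q))
      (pairs a b ∪ Prod.swap ⁻¹' graphOn g B₀) := hg.of_swap
  obtain ⟨j, hj, hSA, hSB⟩ := exists_gap (L := L)
    ((insert c A₀ ∪ B₀.image g) ∪ Finset.univ.image a)
    ((B₀ ∪ (insert c A₀).image f) ∪ Finset.univ.image b) (ρ := fun j => ρ (j₀ + j))
    (fun i i' h => hρ (by omega)) (m := m)
    (by
      refine (Finset.card_union_le _ _).trans (add_le_add ((Finset.card_union_le _ _).trans ?_) ?_)
      · have := Finset.card_image_le (s := B₀) (f := g)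
        omega
      · exact Finset.card_image_le.trans (by simp))
    (by
      refine (Finset.card_union_le _ _).trans (add_le_add ((Finset.card_union_le _ _).trans ?_) ?_)
      · have := Finset.card_image_le (s := insert c A₀) (f := f)
        omega
      · exact Finset.card_image_le.trans (by simp))
  simp only [← add_assoc] at hSA hSB
  have hmA : ∀ i, a i ∈ (insert c A₀ ∪ B₀.image g) ∪ Finset.univ.image a := fun i =>
    Finset.mem_union_right _ (Finset.mem_image_of_mem _ (Finset.mem_univ _))
  have hmB : ∀ i, b i ∈ (B₀ ∪ (insert c A₀).image f) ∪ Finset.univ.image b := fun i =>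
    Finset.mem_union_right _ (Finset.mem_image_of_mem _ (Finset.mem_univ _))
  have hR : ρ (j₀ + j + 1) = 6 * κ + 4 * (ρ (j₀ + j) * N) + 4 * ρ (j₀ + j) + 3 := rfl
  have hRQ : ρ (j₀ + j + 1) ≤ ρ (j₀ + Q) := hρ (by omega)
  have hr₀ : ρ j₀ ≤ ρ (j₀ + j) := hρ (by omega)
  set r := ρ (j₀ + j) with hr
  set R := ρ (j₀ + j + 1) with hRdef
  obtain ⟨q, hpq, hqK, hqA, hqB⟩ := exists_common_simulation (R := R) (r := r) hf hg' (by omega)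
    (by omega)
    (fun x hx y hy => hSA x (Finset.mem_union_left _ hx) y (Finset.mem_union_left _ hy))
    (fun i y hy => hSA _ (hmA i) y (Finset.mem_union_left _ hy))
    (fun x hx y hy => hSB x (Finset.mem_union_left _ hx) y (Finset.mem_union_left _ hy))
    (fun i y hy => hSB _ (hmB i) y (Finset.mem_union_left _ hy))
  obtain ⟨x, hx, hxc⟩ := hqA c (Finset.mem_insert_self _ _)
  -- `r` rounds serve to reach `c`, and `2 * r` each for `N` later elements: `r` from `q` to a
  -- representative and `ρ j₀ ≤ r` from there.
  have hq : LocalSim P (κ + 2 * r * N + r) q := hqK _ (by rw [hR, mul_assoc]; omega)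
  obtain ⟨d, -, hs⟩ := hq.exists_move hx hxc
  refine ⟨d, ?_⟩
  have hTq : pairs (Fin.snoc a c : Fin (n + 1) → A) (Fin.snoc b d : Fin (n + 1) → B) ⊆
      insert (c, d) q := by
    rw [pairs_snoc]
    exact Set.insert_subset_insert hpq
  constructor
  · refine extends_of_near_or_scattered (n := n + 1) hs hTq (encard_pairs_le _ _) fun z => ?_
    rcases hrepA z with ⟨y, hy, hyz⟩ | ⟨v, hvA, hv, hvc⟩
    · obtain ⟨x, hx, hxy⟩ := hqA y (Finset.mem_insert_of_mem hy)
      exact Or.inl ⟨x, Or.inr hx, (hxy.trans hyz).mono (by omega)⟩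
    -- If the colour of `z` is frequent, its counterparts are the images of scattered
    -- representatives `v i`: `z` is simulated by `v i` in `A`, and `v i` by `f (v i)`.
    · have hmem : ∀ i, ((v i, f (v i)) : A × B) ∈ pairs a b ∪ graphOn f (insert c A₀) :=
        fun i => Or.inr ⟨v i, Finset.mem_insert_of_mem (hvA i), rfl⟩
      refine Or.inr ⟨fun i => f (v i), fun i i' hii' hn => hv i i' hii' ?_, fun i => ?_⟩
      · exact (hf.near_iff (by omega) (hmem i) (hmem i')).2 (hn.mono (by omega))
      · exact (hcolA z (v i) (hvc i).symm).comp_singleton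
          ((hf.subset (Set.singleton_subset_iff.2 (hmem i))).mono (by omega))
  · refine extends_of_near_or_scattered (n := n + 1) hs.swap (Set.preimage_mono hTq)
      (by rw [swap_preimage_pairs]; exact encard_pairs_le _ _) fun z => ?_
    rcases hrepB z with ⟨y, hy, hyz⟩ | ⟨v, hvA, hv, hvc⟩
    · obtain ⟨x, hx, hxy⟩ := hqB y hy
      exact Or.inl ⟨x.swap, Or.inr hx, (hxy.trans hyz).mono (by omega)⟩
    · have hmem : ∀ i, ((g (v i), v i) : A × B) ∈ pairs a b ∪ Prod.swap ⁻¹' graphOn g B₀ :=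
        fun i => Or.inr ⟨v i, hvA i, rfl⟩
      refine Or.inr ⟨fun i => g (v i), fun i i' hii' hn => hv i i' hii' ?_, fun i => ?_⟩
      · exact (hg'.near_iff (by omega) (hmem i) (hmem i')).1 (hn.mono (by omega))
      · have h1 : LocalSim P κ {(g (v i), z)} :=
          ((hg'.subset (Set.singleton_subset_iff.2 (hmem i))).mono (by omega)).comp_singleton
            (hcolB (v i) z (hvc i))
        exact h1.swap.subset (by rintro _ rfl; rfl)

/-! ### Formulae describing local simulations -/

namespace BallFormula

/-- The dual formula, in negation normal form. -/
def neg : {n : ℕ} → BallFormula L n → BallFormula L n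
  | _, eq i j => ne i j
  | _, ne i j => eq i j
  | _, rel R x => nrel R x
  | _, nrel R x => rel R x
  | _, and φ θ => or φ.neg θ.neg
  | _, or φ θ => and φ.neg θ.neg
  | _, exBall r y φ => allBall r y φ.neg
  | _, allBall r y φ => exBall r y φ.neg

theorem realize_neg {M : Type w} [L.Structure M] {n : ℕ} (φ : BallFormula L n) (a : Fin n → M) :
    φ.neg.Realize a ↔ ¬ φ.Realize a := by
  induction φ with
  | eq | ne | rel | nrel => simp [neg, Realize]
  | and φ θ h₁ h₂ => simp only [neg, Realize, h₁, h₂]; tauto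
  | or φ θ h₁ h₂ => simp only [neg, Realize, h₁, h₂]; tauto
  | exBall r y φ h => simp only [neg, Realize, h]; push Not; rfl
  | allBall r y φ h => simp only [neg, Realize, h]; push Not; rfl

theorem occurs_neg (S : Σ l, L.Relations l) (b : Bool) {n : ℕ} (φ : BallFormula L n) :
    φ.neg.Occurs S b ↔ φ.Occurs S (!b) := by
  induction φ with
  | eq | ne | rel | nrel => simp [neg, Occurs]
  | and φ θ h₁ h₂ => simp only [neg, Occurs, h₁, h₂]
  | or φ θ h₁ h₂ => simp only [neg, Occurs, h₁, h₂]
  | exBall r y φ h => simp only [neg, Occurs, h]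
  | allBall r y φ h => simp only [neg, Occurs, h]

theorem pathsLE_neg (r : ℕ) {n : ℕ} (d : Fin n → ℕ) (φ : BallFormula L n) :
    φ.neg.PathsLE r d ↔ φ.PathsLE r d := by
  induction φ with
  | eq | ne | rel | nrel => simp [neg, PathsLE]
  | and φ θ h₁ h₂ => simp only [neg, PathsLE, h₁, h₂]
  | or φ θ h₁ h₂ => simp only [neg, PathsLE, h₁, h₂]
  | exBall r y φ h => simp only [neg, PathsLE, h]
  | allBall r y φ h => simp only [neg, PathsLE, h]

theorem PathsLE.mono {r s : ℕ} (hrs : r ≤ s) {n : ℕ} {d : Fin n → ℕ} {φ : BallFormula L n}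
    (h : φ.PathsLE r d) : φ.PathsLE s d := by
  induction φ with
  | eq | ne | rel | nrel => trivial
  | and φ θ h₁ h₂ => exact ⟨h₁ h.1, h₂ h.2⟩
  | or φ θ h₁ h₂ => exact ⟨h₁ h.1, h₂ h.2⟩
  | exBall r y φ ih => exact ⟨h.1.trans hrs, ih h.2⟩
  | allBall r y φ ih => exact ⟨h.1.trans hrs, ih h.2⟩

theorem exists_pathsLE {n : ℕ} (φ : BallFormula L n) (d : Fin n → ℕ) : ∃ r, φ.PathsLE r d := by
  induction φ with
  | eq | ne | rel | nrel => exact ⟨0, trivial⟩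
  | and φ θ h₁ h₂ | or φ θ h₁ h₂ =>
    obtain ⟨r, hr⟩ := h₁ d
    obtain ⟨s, hs⟩ := h₂ d
    exact ⟨max r s, hr.mono (le_max_left _ _), hs.mono (le_max_right _ _)⟩
  | exBall s y φ ih | allBall s y φ ih =>
    obtain ⟨r, hr⟩ := ih (Fin.snoc d (d y + s))
    exact ⟨max (d y + s) r, le_max_left _ _, hr.mono (le_max_right _ _)⟩

/-- The conjunction of finitely many formulae. -/
noncomputable def conj {n : ℕ} (s : Finset (BallFormula L (n + 1))) : BallFormula L (n + 1) :=
  s.toList.foldr and (eq 0 0)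

/-- The disjunction of finitely many formulae. -/
noncomputable def disj {n : ℕ} (s : Finset (BallFormula L (n + 1))) : BallFormula L (n + 1) :=
  s.toList.foldr or (ne 0 0)

theorem realize_conj {M : Type w} [L.Structure M] {n : ℕ} (s : Finset (BallFormula L (n + 1)))
    (a : Fin (n + 1) → M) : (conj s).Realize a ↔ ∀ φ ∈ s, φ.Realize a := by
  have : ∀ l : List (BallFormula L (n + 1)),
      (l.foldr and (eq 0 0)).Realize a ↔ ∀ φ ∈ l, φ.Realize a := by
    intro l
    induction l with
    | nil => simp [Realize]
    | cons φ l ih => simp [Realize, ih]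
  simpa [conj] using this s.toList

theorem realize_disj {M : Type w} [L.Structure M] {n : ℕ} (s : Finset (BallFormula L (n + 1)))
    (a : Fin (n + 1) → M) : (disj s).Realize a ↔ ∃ φ ∈ s, φ.Realize a := by
  have : ∀ l : List (BallFormula L (n + 1)),
      (l.foldr or (ne 0 0)).Realize a ↔ ∃ φ ∈ l, φ.Realize a := by
    intro l
    induction l with
    | nil => simp [Realize]
    | cons φ l ih => simp [Realize, ih]
  simpa [disj] using this s.toList

/-- All symbols of the formula occur with signs in `P`. -/
def HasSigns (P : Signs L) {n : ℕ} (φ : BallFormula L n) : Prop :=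
  ∀ S b, φ.Occurs S b → P S b

theorem hasSigns_conj {P : Signs L} {n : ℕ} {s : Finset (BallFormula L (n + 1))}
    (h : ∀ φ ∈ s, φ.HasSigns P) : (conj s).HasSigns P := by
  have : ∀ l : List (BallFormula L (n + 1)), (∀ φ ∈ l, φ.HasSigns P) →
      (l.foldr and (eq 0 0)).HasSigns P := by
    intro l
    induction l with
    | nil => intro _ S b hS; exact hS.elim
    | cons φ l ih =>
      intro hl S b hS
      rcases hS with hS | hS
      · exact hl φ (by simp) S b hS
      · exact ih (fun θ hθ => hl θ (by simp [hθ])) S b hS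
  exact this _ (by simpa using h)

theorem hasSigns_disj {P : Signs L} {n : ℕ} {s : Finset (BallFormula L (n + 1))}
    (h : ∀ φ ∈ s, φ.HasSigns P) : (disj s).HasSigns P := by
  have : ∀ l : List (BallFormula L (n + 1)), (∀ φ ∈ l, φ.HasSigns P) →
      (l.foldr or (ne 0 0)).HasSigns P := by
    intro l
    induction l with
    | nil => intro _ S b hS; exact hS.elim
    | cons φ l ih =>
      intro hl S b hS
      rcases hS with hS | hS
      · exact hl φ (by simp) S b hS
      · exact ih (fun θ hθ => hl θ (by simp [hθ])) S b hS
  exact this _ (by simpa using h)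

end BallFormula

open BallFormula in
/-- The literals in finitely many variables. -/
theorem exists_literals [Finite (Σ l, L.Relations l)] (P : Signs L) (n : ℕ) :
    ∃ Λ : Finset (BallFormula L n), (∀ φ ∈ Λ, φ.HasSigns P) ∧
      ∀ (A B : Type w) [L.Structure A] [L.Structure B] (a : Fin n → A) (b : Fin n → B),
        (∀ φ ∈ Λ, φ.Realize a → φ.Realize b) → PreservesLiterals P (pairs a b) := by
  classical
  have : Fintype (Σ R : (Σ l, L.Relations l), Fin R.1 → Fin n) := Fintype.ofFinite _
  let Λ : Finset (BallFormula L n) :=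
    (Finset.univ.image fun x : Fin n × Fin n => BallFormula.eq x.1 x.2) ∪
    (Finset.univ.image fun x : Fin n × Fin n => BallFormula.ne x.1 x.2) ∪
    ((Finset.univ.filter fun x : Σ R : (Σ l, L.Relations l), Fin R.1 → Fin n => P x.1 true).image
      fun x => BallFormula.rel x.1.2 x.2) ∪
    ((Finset.univ.filter fun x : Σ R : (Σ l, L.Relations l), Fin R.1 → Fin n => P x.1 false).image
      fun x => BallFormula.nrel x.1.2 x.2)
  refine ⟨Λ, ?_, ?_⟩
  · intro φ hφ S b hS
    simp only [Λ, Finset.mem_union, Finset.mem_image, Finset.mem_filter, Finset.mem_univ,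
      true_and] at hφ
    rcases hφ with ((⟨x, rfl⟩ | ⟨x, rfl⟩) | ⟨x, hx, rfl⟩) | ⟨x, hx, rfl⟩
    · exact hS.elim
    · exact hS.elim
    · obtain ⟨rfl, rfl⟩ := hS
      exact hx
    · obtain ⟨rfl, rfl⟩ := hS
      exact hx
  · intro A B _ _ a b h
    simp only [Λ, Finset.mem_union, Finset.mem_image, Finset.mem_filter, Finset.mem_univ,
      true_and] at h
    refine ⟨?_, fun l R c hc => ?_⟩
    · rintro _ ⟨i, rfl⟩ _ ⟨j, rfl⟩
      have h1 := h (.eq i j) (Or.inl (Or.inl (Or.inl ⟨(i, j), rfl⟩)))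
      have h2 := h (.ne i j) (Or.inl (Or.inl (Or.inr ⟨(i, j), rfl⟩)))
      exact ⟨h1, fun hb => by_contra fun ha => h2 ha hb⟩
    · choose x hx using hc
      obtain rfl : c = fun i => (a (x i), b (x i)) := funext fun i => (hx i).symm
      refine ⟨fun hP => ?_, fun hP hb => by_contra fun ha => ?_⟩
      · exact h (.rel R x) (Or.inl (Or.inr ⟨⟨⟨l, R⟩, x⟩, hP, rfl⟩))
      · exact h (.nrel R x) (Or.inr ⟨⟨⟨l, R⟩, x⟩, hP, rfl⟩) ha hb

open BallFormula in
/-- Finitely many formulae suffice to describe local simulations. -/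
theorem exists_localSim_formulas [Finite (Σ l, L.Relations l)] (P : Signs L) (k n : ℕ) :
    ∃ Λ : Finset (BallFormula L n), (∀ φ ∈ Λ, φ.HasSigns P) ∧
      ∀ (A B : Type w) [L.Structure A] [L.Structure B] (a : Fin n → A) (b : Fin n → B),
        (∀ φ ∈ Λ, φ.Realize a → φ.Realize b) → LocalSim P k (pairs a b) := by
  classical
  induction k generalizing n with
  | zero => exact exists_literals P n
  | succ k ih =>
    obtain ⟨Λ₀, hs₀, h₀⟩ := ih n
    obtain ⟨Λ, hs, h⟩ := ih (n + 1)
    refine ⟨Λ₀ ∪ (Finset.univ ×ˢ Λ.powerset).image (fun x : Fin n × _ => exBall 1 x.1 (conj x.2)) ∪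
      (Finset.univ ×ˢ Λ.powerset).image (fun x : Fin n × _ => allBall 1 x.1 (disj x.2)), ?_, ?_⟩
    · intro φ hφ
      simp only [Finset.mem_union, Finset.mem_image, Finset.mem_product, Finset.mem_univ,
        Finset.mem_powerset, true_and] at hφ
      rcases hφ with (hφ | ⟨x, hx, rfl⟩) | ⟨x, hx, rfl⟩
      · exact hs₀ φ hφ
      · exact hasSigns_conj fun φ hφ => hs φ (hx hφ)
      · exact hasSigns_disj fun φ hφ => hs φ (hx hφ)
    · intro A B _ _ a b hab
      simp only [Finset.mem_union, Finset.mem_image, Finset.mem_product, Finset.mem_univ,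
        Finset.mem_powerset, true_and] at hab
      refine ⟨h₀ A B a b fun φ hφ => hab φ (Or.inl (Or.inl hφ)), ?_, ?_⟩
      · rintro _ ⟨i, rfl⟩ c hc
        have := hab (exBall 1 i (conj (Λ.filter fun φ => φ.Realize (Fin.snoc a c : Fin (n+1) → A))))
          (Or.inl (Or.inr ⟨(i, _), Finset.filter_subset _ _, rfl⟩))
          ⟨c, hc, (realize_conj _ _).2 fun φ hφ => (Finset.mem_filter.1 hφ).2⟩
        obtain ⟨d, hd, hcd⟩ := this
        rw [realize_conj] at hcd
        refine ⟨d, hd, ?_⟩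
        rw [← pairs_snoc]
        exact h A B _ _ fun φ hφ hr => hcd φ (Finset.mem_filter.2 ⟨hφ, hr⟩)
      · rintro _ ⟨i, rfl⟩ d hd
        -- The disjunction of all formulae false at `d` fails in `B`, hence in `A`. This gives a `c`
        -- at which all of them are false.
        have := mt (hab (allBall 1 i
            (disj (Λ.filter fun φ => ¬ φ.Realize (Fin.snoc b d : Fin (n+1) → B))))
          (Or.inr ⟨(i, _), Finset.filter_subset _ _, rfl⟩))
          (by
            intro hall
            obtain ⟨φ, hφ, hr⟩ := (realize_disj _ _).1 (hall d hd)
            exact (Finset.mem_filter.1 hφ).2 hr)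
        simp only [BallFormula.Realize, realize_disj] at this
        push Not at this
        obtain ⟨c, hc, hcd⟩ := this
        refine ⟨c, hc, ?_⟩
        rw [← pairs_snoc]
        exact h A B _ _ fun φ hφ hr => by_contra fun hn =>
          hcd φ (Finset.mem_filter.2 ⟨hφ, hn⟩) hr

theorem pairs_const {A B : Type w} (x : A) (y : B) :
    pairs (fun _ : Fin 1 => x) (fun _ => y) = {(x, y)} := by
  simp [pairs, Set.range_const]

/-- The colour is the set of describing formulae that hold at the element. Equal colours give
simulations in both directions, so the number of colours does not depend on the structure. -/
theorem exists_colouring [Finite (Σ l, L.Relations l)] (P : Signs L) (k : ℕ) :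
    ∃ C : ℕ, ∀ (A : Type w) [L.Structure A], ∃ col : A → Fin C,
      ∀ x y, col x = col y → LocalSim P k {(x, y)} := by
  classical
  obtain ⟨Λ, -, h⟩ := exists_localSim_formulas P k 1
  refine ⟨Fintype.card (Set Λ), fun A _ =>
    ⟨fun x => Fintype.equivFin (Set Λ) {φ | φ.1.Realize fun _ => x}, fun x y hxy => ?_⟩⟩
  rw [← pairs_const]
  refine h A A _ _ fun φ hφ hx => ?_
  have := (Fintype.equivFin (Set Λ)).injective hxy
  have hm : (⟨φ, hφ⟩ : Λ) ∈ {φ : Λ | φ.1.Realize fun _ => x} := hx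
  rw [this] at hm
  exact hm

/-- Global simulations with sufficiently many rounds preserve first-order formulae. -/
theorem exists_globalSim_realize [L.IsRelational] [Finite (Σ l, L.Relations l)] {n : ℕ}
    (φ : L.BoundedFormula Empty n) (P : Signs L) (hP : ∀ S b, FOOccurs S b φ → P S b) :
    ∃ N k, ∀ (A B : Type w) [L.Structure A] [L.Structure B] [Nonempty A] [Nonempty B]
      (a : Fin n → A) (b : Fin n → B), GlobalSim P k N (pairs a b) →
        φ.Realize default a → φ.Realize default b := by
  have hterm : ∀ {n : ℕ} (t : L.Term (Empty ⊕ Fin n)), ∃ i, t = Term.var (Sum.inr i) := by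
    intro n t
    cases t with
    | var x =>
      rcases x with x | i
      · exact x.elim
      · exact ⟨i, rfl⟩
    | func f _ => exact isEmptyElim f
  induction φ generalizing P with
  | falsum => exact ⟨0, 0, fun A B _ _ _ _ a b _ h => h⟩
  | equal t₁ t₂ =>
    refine ⟨0, 0, fun A B _ _ _ _ a b hG h => ?_⟩
    obtain ⟨i, rfl⟩ := hterm t₁
    obtain ⟨j, rfl⟩ := hterm t₂
    exact (hG.localSim.preservesLiterals.1 (a i, b i) ⟨i, rfl⟩ (a j, b j) ⟨j, rfl⟩).1 h
  | rel R ts =>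
    refine ⟨0, 0, fun A B _ _ _ _ a b hG h => ?_⟩
    choose x hx using fun i => hterm (ts i)
    obtain rfl : ts = fun i => Term.var (Sum.inr (x i)) := funext hx
    exact (hG.localSim.preservesLiterals.2 _ R (fun i => (a (x i), b (x i)))
      fun i => ⟨x i, rfl⟩).1 (hP _ _ ⟨rfl, rfl⟩) h
  | imp φ θ ih₁ ih₂ =>
    obtain ⟨N₁, k₁, h₁⟩ := ih₁ P.dual fun S b h => hP S (!b) (Or.inl (by simpa using h))
    obtain ⟨N₂, k₂, h₂⟩ := ih₂ P fun S b h => hP S b (Or.inr h)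
    refine ⟨max N₁ N₂, max k₁ k₂, fun A B _ _ _ _ a b hG h => ?_⟩
    rw [BoundedFormula.realize_imp] at h ⊢
    intro hb
    refine h₂ A B a b (hG.mono (le_max_right _ _) (le_max_right _ _)) (h ?_)
    refine h₁ B A b a ?_ hb
    rw [← swap_preimage_pairs]
    exact (hG.mono (le_max_left _ _) (le_max_left _ _)).swap
  | @all n φ ih =>
    obtain ⟨N, k, h⟩ := ih P hP
    -- The counterexample to a universal formula is chosen in `B`, so the game is played from `B` to
    -- `A` with dual signs.
    obtain ⟨C, hC⟩ := exists_colouring P.dual (level k N)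
    obtain ⟨N', k', hs⟩ := exists_globalSim_snoc P.dual n N k C hC
    refine ⟨N', k', fun A B _ _ _ _ a b hG hφ => ?_⟩
    rw [BoundedFormula.realize_all] at hφ ⊢
    intro d
    have hG' := hG.swap
    rw [swap_preimage_pairs] at hG'
    obtain ⟨c, hc⟩ := hs B A b a hG' d
    have hc' := hc.swap
    rw [swap_preimage_pairs, Signs.dual_dual] at hc'
    exact h A B _ _ hc' (hφ c)

/-! ### Local sentences and the global simulations they enforce -/

namespace LocalSentence

/-- The dual local sentence. -/
def neg : LocalSentence L → LocalSentence L
  | exScattered r m hm φ hφ => allScattered r m hm φ.neg ((φ.pathsLE_neg r _).2 hφ)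
  | allScattered r m hm φ hφ => exScattered r m hm φ.neg ((φ.pathsLE_neg r _).2 hφ)
  | and χ₁ χ₂ => or χ₁.neg χ₂.neg
  | or χ₁ χ₂ => and χ₁.neg χ₂.neg

theorem realize_neg (M : Type w) [L.Structure M] (χ : LocalSentence L) :
    χ.neg.Realize M ↔ ¬ χ.Realize M := by
  induction χ with
  | exScattered r m hm φ hφ =>
    simp only [neg, Realize, BallFormula.realize_neg, not_exists, not_and_or, not_forall, not_lt,
      exists_prop]
  | allScattered r m hm φ hφ =>
    simp only [neg, Realize, BallFormula.realize_neg, not_forall, not_or, not_exists, not_and,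
      not_le]
  | and χ₁ χ₂ h₁ h₂ => simp only [neg, Realize, h₁, h₂]; tauto
  | or χ₁ χ₂ h₁ h₂ => simp only [neg, Realize, h₁, h₂]; tauto

theorem occurs_neg (S : Σ l, L.Relations l) (b : Bool) (χ : LocalSentence L) :
    χ.neg.Occurs S b ↔ χ.Occurs S (!b) := by
  induction χ with
  | exScattered | allScattered => simp only [neg, Occurs, BallFormula.occurs_neg]
  | and χ₁ χ₂ h₁ h₂ => simp only [neg, Occurs, h₁, h₂]
  | or χ₁ χ₂ h₁ h₂ => simp only [neg, Occurs, h₁, h₂]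

/-- All symbols of the sentence occur with signs in `P`. -/
def HasSigns (P : Signs L) (χ : LocalSentence L) : Prop :=
  ∀ S b, χ.Occurs S b → P S b

/-- A true local sentence. -/
def top : LocalSentence L :=
  exScattered 0 1 le_rfl (.eq 0 0) (by simp [BallFormula.IsLocal, BallFormula.PathsLE])

/-- A false local sentence. -/
def bot : LocalSentence L :=
  exScattered 0 1 le_rfl (.ne 0 0) (by simp [BallFormula.IsLocal, BallFormula.PathsLE])

/-- The conjunction of finitely many local sentences. -/
noncomputable def conj (s : Finset (LocalSentence L)) : LocalSentence L :=
  s.toList.foldr and top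

/-- The disjunction of finitely many local sentences. -/
noncomputable def disj (s : Finset (LocalSentence L)) : LocalSentence L :=
  s.toList.foldr or bot

theorem realize_conj (M : Type w) [L.Structure M] [Nonempty M] (s : Finset (LocalSentence L)) :
    (conj s).Realize M ↔ ∀ χ ∈ s, χ.Realize M := by
  have : ∀ l : List (LocalSentence L),
      (l.foldr and top).Realize M ↔
        ∀ χ ∈ l, χ.Realize M := by
    intro l
    induction l with
    | nil =>
      refine iff_of_true ⟨fun _ => Classical.arbitrary M, fun i j hij => ?_, fun i => rfl⟩ (by simp)
      omega
    | cons φ l ih => simp [Realize, ih]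
  simpa [conj] using this s.toList

theorem realize_disj (M : Type w) [L.Structure M] (s : Finset (LocalSentence L)) :
    (disj s).Realize M ↔ ∃ χ ∈ s, χ.Realize M := by
  have : ∀ l : List (LocalSentence L),
      (l.foldr or bot).Realize M ↔
        ∃ χ ∈ l, χ.Realize M := by
    intro l
    induction l with
    | nil =>
      refine iff_of_false ?_ (by simp)
      rintro ⟨y, -, hy⟩
      exact hy 0 rfl
    | cons φ l ih => simp [Realize, ih]
  simpa [disj] using this s.toList

theorem hasSigns_conj {P : Signs L} {s : Finset (LocalSentence L)}
    (h : ∀ χ ∈ s, χ.HasSigns P) : (conj s).HasSigns P := by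
  have : ∀ l : List (LocalSentence L), (∀ χ ∈ l, χ.HasSigns P) →
      (l.foldr and top).HasSigns P := by
    intro l
    induction l with
    | nil => intro _ S b hS; exact hS.elim
    | cons φ l ih =>
      intro hl S b hS
      rcases hS with hS | hS
      · exact hl φ (by simp) S b hS
      · exact ih (fun θ hθ => hl θ (by simp [hθ])) S b hS
  exact this _ (by simpa using h)

theorem hasSigns_disj {P : Signs L} {s : Finset (LocalSentence L)}
    (h : ∀ χ ∈ s, χ.HasSigns P) : (disj s).HasSigns P := by
  have : ∀ l : List (LocalSentence L), (∀ χ ∈ l, χ.HasSigns P) →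
      (l.foldr or bot).HasSigns P := by
    intro l
    induction l with
    | nil => intro _ S b hS; exact hS.elim
    | cons φ l ih =>
      intro hl S b hS
      rcases hS with hS | hS
      · exact hl φ (by simp) S b hS
      · exact ih (fun θ hθ => hl θ (by simp [hθ])) S b hS
  exact this _ (by simpa using h)

end LocalSentence

theorem not_near_iff {M : Type w} [L.Structure M] {s : ℕ} {a b : M} :
    ¬ Near L s a b ↔ (s : ℕ∞) < gdist L a b :=
  not_le

/-- Finitely many basic local sentences suffice to find scattered counterparts of scattered
elements. -/
theorem exists_sentences_scattered [Finite (Σ l, L.Relations l)] (P : Signs L) (K N D : ℕ) :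
    ∃ (Δ : Finset (LocalSentence L)) (R : ℕ), (∀ χ ∈ Δ, χ.HasSigns P) ∧
      ∀ (A B : Type w) [L.Structure A] [L.Structure B],
        (∀ χ ∈ Δ, χ.Realize A → χ.Realize B) → ∀ U : Finset A, U.card ≤ N →
        IsScattered L R (fun u : U => (u : A)) →
        ∃ g : U → B, (∀ u : U, LocalSim P K {((u : A), g u)}) ∧ IsScattered L D g := by
  classical
  obtain ⟨Λ, hs, hΛ⟩ := exists_localSim_formulas P K 1
  -- An element of `T` is a type, given by the formulae that hold; `θ T` says that one of the types
  -- in `T` is attained or exceeded.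
  let θ : Finset (Finset (BallFormula L 1)) → BallFormula L 1 := fun T =>
    BallFormula.disj (T.image BallFormula.conj)
  choose ρ hρ using fun T => (θ T).exists_pathsLE fun _ => 0
  set E := D * 2 ^ ((2 ^ N * N) ^ 2 + 1) with hE
  -- One radius for all `T`: it makes every `θ T` local and `2 * r` at least the separation `E` that
  -- the transversal needs.
  set r := E + Λ.powerset.powerset.sup ρ with hr
  have hloc : ∀ T : Λ.powerset.powerset, (θ T).IsLocal r := fun T =>
    (hρ T).mono ((Finset.le_sup (f := ρ) T.2).trans (by omega))
  refine ⟨Finset.univ.image fun x : Finset.Icc 1 N × Λ.powerset.powerset =>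
    .exScattered r x.1 (Finset.mem_Icc.1 x.1.2).1 (θ x.2) (hloc x.2), 2 * r, ?_, ?_⟩
  · intro χ hχ
    obtain ⟨x, -, rfl⟩ := Finset.mem_image.1 hχ
    refine BallFormula.hasSigns_disj fun φ hφ => ?_
    obtain ⟨T, hT, rfl⟩ := Finset.mem_image.1 hφ
    exact BallFormula.hasSigns_conj fun φ hφ =>
      hs φ (Finset.mem_powerset.1 (Finset.mem_powerset.1 x.2.2 hT) hφ)
  · intro A B _ _ hAB U hU hsc
    obtain ⟨g, hg, hgs⟩ := exists_scattered_transversal (L := L) (ι := U)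
      (fun u => {y : B | ∀ φ ∈ Λ, φ.Realize (fun _ => (u : A)) → φ.Realize fun _ => y}) D (m := N)
      (by simpa using hU) (by
        intro I
        rcases I.eq_empty_or_nonempty with rfl | hI
        · exact ⟨fun x => absurd x.2 (by simp), fun x => absurd x.2 (by simp),
            fun x => absurd x.2 (by simp)⟩
        have hIN : I.card ≤ N := (Finset.card_le_univ I).trans (by simpa using hU)
        let T : Finset (Finset (BallFormula L 1)) :=
          I.image fun u : U => Λ.filter fun φ => φ.Realize fun _ => (u : A)
        have hT : T ∈ Λ.powerset.powerset := by
          refine Finset.mem_powerset.2 fun t ht => ?_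
          obtain ⟨u, -, rfl⟩ := Finset.mem_image.1 ht
          exact Finset.mem_powerset.2 (Finset.filter_subset _ _)
        obtain ⟨w, hw, hwT⟩ := hAB _ (Finset.mem_image_of_mem _ (Finset.mem_univ
          (⟨⟨I.card, Finset.mem_Icc.2 ⟨hI.card_pos, hIN⟩⟩, ⟨T, hT⟩⟩ :
            Finset.Icc 1 N × Λ.powerset.powerset)))
          (by
            refine ⟨fun i => (I.equivFin.symm i).1.1, fun i j hij => ?_, fun i => ?_⟩
            · rw [← not_near_iff]
              refine hsc _ _ fun h => hij.ne ?_
              exact I.equivFin.symm.injective (Subtype.ext h)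
            · refine (BallFormula.realize_disj _ _).2 ⟨_, Finset.mem_image_of_mem _
                (Finset.mem_image_of_mem _ (I.equivFin.symm i).2), ?_⟩
              exact (BallFormula.realize_conj _ _).2 fun φ hφ => (Finset.mem_filter.1 hφ).2)
        refine ⟨w, fun i j hij hn => ?_, fun x => ?_⟩
        · have hn' := hn.mono (by omega : _ ≤ 2 * r)
          rcases lt_or_gt_of_ne hij with h | h
          · exact not_near_iff.2 (hw i j h) hn'
          · exact not_near_iff.2 (hw j i h) hn'.symm
        · obtain ⟨φ, hφ, hx⟩ := (BallFormula.realize_disj _ _).1 (hwT x)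
          obtain ⟨t, ht, rfl⟩ := Finset.mem_image.1 hφ
          obtain ⟨u, hu, rfl⟩ := Finset.mem_image.1 ht
          rw [BallFormula.realize_conj] at hx
          exact ⟨u, hu, fun φ hφ hφu => hx φ (Finset.mem_filter.2 ⟨hφ, hφu⟩)⟩)
    refine ⟨g, fun u => ?_, hgs⟩
    rw [← pairs_const]
    exact hΛ A B _ _ (hg u)

/-- Finitely many basic local sentences suffice to find counterparts of finitely many elements. -/
theorem exists_sentences_extends [Finite (Σ l, L.Relations l)] (P : Signs L) (k N : ℕ) :
    ∃ Δ : Finset (LocalSentence L), (∀ χ ∈ Δ, χ.HasSigns P) ∧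
      ∀ (A B : Type w) [L.Structure A] [L.Structure B] [Nonempty A] [Nonempty B],
        (∀ χ ∈ Δ, χ.Realize A → χ.Realize B) → Extends P k N (∅ : Set (A × B)) := by
  classical
  have hex := fun r : ℕ => exists_sentences_scattered.{u, v, w} P (k + r * (N + 1)) (N + 1)
    (2 * (k + r * (N + 1)) + 1)
  choose Δ R hΔ h using hex
  -- At scale `ρ j`, simulations need `ρ j * (N + 1)` spare rounds to reach the elements around the
  -- centres. The next scale is large enough to find counterparts of the centres and to unite these
  -- simulations.
  let ρ : ℕ → ℕ := fun j => Nat.rec 0 (fun _ r => max (R r) (2 * (k + r * (N + 1)) + 1 + r)) j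
  have hρ : ∀ j, ρ (j + 1) = max (R (ρ j)) (2 * (k + ρ j * (N + 1)) + 1 + ρ j) := fun j => rfl
  refine ⟨(Finset.range ((N + 1) ^ 2 + 1)).biUnion fun j => Δ (ρ j), ?_, ?_⟩
  · intro χ hχ
    obtain ⟨j, -, hj⟩ := Finset.mem_biUnion.1 hχ
    exact hΔ _ χ hj
  · intro A B _ _ _ _ hAB Z hZ
    -- The extra element keeps the set of centres non-empty even if `Z` is empty, as uniting
    -- simulations requires.
    let a₀ : A := Classical.arbitrary A
    set Z' : Finset A := insert a₀ Z with hZ'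
    have hZc : Z'.card ≤ N + 1 := (Finset.card_insert_le _ _).trans (by omega)
    obtain ⟨j, hj, hst⟩ := exists_stable
      (I := Z' × Z')
      (fun j x => Near L (ρ j) x.1.1 x.2.1)
      (fun x j hx => hx.mono (by rw [hρ]; exact le_max_of_le_right (by omega)))
      (m := (N + 1) ^ 2) (by
        rw [Fintype.card_prod, Fintype.card_coe, ← sq]
        gcongr)
    -- A maximal scattered subset at scale `ρ (j + 1)` covers `Z'` at that scale, hence at scale `ρ
    -- j` by the choice of `j`.
    obtain ⟨U, hU, hUmax⟩ := Finset.exists_max_image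
      (Z'.powerset.filter fun U : Finset A => IsScattered L (ρ (j + 1)) fun u : U => (u : A))
      Finset.card ⟨∅, Finset.mem_filter.2 ⟨by simp, fun x => absurd x.2 (Finset.notMem_empty _)⟩⟩
    obtain ⟨hUZ, hUs⟩ := Finset.mem_filter.1 hU
    rw [Finset.mem_powerset] at hUZ
    have hcov : ∀ z ∈ Z', ∃ u ∈ U, Near L (ρ j) u z := by
      intro z hz
      by_contra! hcon
      have hzU : z ∉ U := fun h => hcon z h (Near.refl _ _)
      have hfar : ∀ u ∈ U, ¬ Near L (ρ (j + 1)) u z := fun u hu hn =>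
        hcon u hu (hst (⟨u, hUZ hu⟩, ⟨z, hz⟩) hn)
      have := hUmax (insert z U) (Finset.mem_filter.2 ⟨Finset.mem_powerset.2
        (Finset.insert_subset hz hUZ), by
          rintro ⟨x, hx⟩ ⟨y, hy⟩ hxy hn
          simp only [ne_eq, Subtype.mk.injEq] at hxy
          rcases Finset.mem_insert.1 hx with hx' | hx' <;>
            rcases Finset.mem_insert.1 hy with hy' | hy'
          · exact hxy (hx'.trans hy'.symm)
          · exact hfar y hy' (hx' ▸ hn.symm)
          · exact hfar x hx' (hy' ▸ hn)
          · exact hUs ⟨x, hx'⟩ ⟨y, hy'⟩ (fun h => hxy (congrArg Subtype.val h)) hn⟩)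
      rw [Finset.card_insert_of_notMem hzU] at this
      omega
    obtain ⟨u₀, hu₀, -⟩ := hcov a₀ (Finset.mem_insert_self _ _)
    have : Nonempty U := ⟨⟨u₀, hu₀⟩⟩
    obtain ⟨g, hg, hgs⟩ := h (ρ j) A B
      (fun χ hχ => hAB χ (Finset.mem_biUnion.2 ⟨j, Finset.mem_range.2 (by omega), hχ⟩)) U
      ((Finset.card_le_card hUZ).trans hZc) (hUs.mono (by rw [hρ]; exact le_max_left _ _))
    have hsim : LocalSim P (k + ρ j * (N + 1)) (⋃ u : U, {((u : A), g u)}) := by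
      refine LocalSim.iUnion hg fun u u' huu' => ?_
      rintro _ rfl _ rfl
      refine ⟨fun hn => hUs u u' huu' (hn.mono ?_), hgs u u' huu'⟩
      rw [hρ]
      exact le_max_of_le_right (by omega)
    obtain ⟨f, hf⟩ := LocalSim.exists_extend_near (k := k) (s := ρ j) Z
      (hsim.mono (by gcongr; omega)) fun z hz => by
        obtain ⟨u, hu, hn⟩ := hcov z (Finset.mem_insert_of_mem hz)
        exact ⟨(u, g ⟨u, hu⟩), Set.mem_iUnion.2 ⟨⟨u, hu⟩, rfl⟩, hn⟩
    exact ⟨f, hf.subset (Set.union_subset_union_left _ (Set.empty_subset _))⟩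

/-- Finitely many basic local sentences suffice for the existence of a global simulation. -/
theorem exists_sentences_globalSim [Finite (Σ l, L.Relations l)] (P : Signs L) (k N : ℕ) :
    ∃ Δ : Finset (LocalSentence L), (∀ χ ∈ Δ, χ.HasSigns P) ∧
      ∀ (A B : Type w) [L.Structure A] [L.Structure B] [Nonempty A] [Nonempty B],
        (∀ χ ∈ Δ, χ.Realize A → χ.Realize B) → GlobalSim P k N (∅ : Set (A × B)) := by
  classical
  obtain ⟨Δ₁, hs₁, h₁⟩ := exists_sentences_extends.{u, v, w} P k N
  obtain ⟨Δ₂, hs₂, h₂⟩ := exists_sentences_extends.{u, v, w} P.dual k N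
  -- Preserving the negations from `A` to `B` is the same as preserving `Δ₂` from `B` to `A`;
  -- negating turns the dual signs back into `P`.
  refine ⟨Δ₁ ∪ Δ₂.image LocalSentence.neg, fun χ hχ => ?_, fun A B _ _ _ _ h => ?_⟩
  · rcases Finset.mem_union.1 hχ with hχ | hχ
    · exact hs₁ χ hχ
    · obtain ⟨χ, hχ', rfl⟩ := Finset.mem_image.1 hχ
      intro S b hS
      have := hs₂ χ hχ' S (!b) ((χ.occurs_neg S b).1 hS)
      simpa [Signs.dual] using this
  · refine ⟨h₁ A B fun χ hχ => h χ (Finset.mem_union_left _ hχ), h₂ B A fun χ hχ hB => ?_⟩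
    by_contra hA
    exact (χ.realize_neg B).1 (h χ.neg (Finset.mem_union_right _ (Finset.mem_image_of_mem _ hχ))
      ((χ.realize_neg A).2 hA)) hB

end Gaifman

/-! ### The normal form -/

theorem mainTheorem2 (L : FirstOrder.Language.{u, v}) [L.IsRelational]
    [Finite (Σ l, L.Relations l)] (ψ : L.Sentence) :
    ∃ ψ' : Gaifman.LocalSentence L,
      (∀ (M : Type w) [L.Structure M] [Nonempty M],
        FirstOrder.Language.Sentence.Realize M ψ ↔ ψ'.Realize M) ∧
      ∀ S : Σ l, L.Relations l,
        (¬ Gaifman.FOOccurs S false ψ → ¬ ψ'.Occurs S false) ∧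
        (¬ Gaifman.FOOccurs S true ψ → ¬ ψ'.Occurs S true) := by
  classical
  let P : Gaifman.Signs L := fun S b => Gaifman.FOOccurs S b ψ
  obtain ⟨N, k, hNk⟩ := Gaifman.exists_globalSim_realize.{u, v, w} ψ P fun S b h => h
  obtain ⟨Δ, hs, hΔ⟩ := Gaifman.exists_sentences_globalSim.{u, v, w} P k N
  have key : ∀ (A B : Type w) [L.Structure A] [L.Structure B] [Nonempty A] [Nonempty B],
      (∀ χ ∈ Δ, χ.Realize A → χ.Realize B) → FirstOrder.Language.Sentence.Realize A ψ →
        FirstOrder.Language.Sentence.Realize B ψ := by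
    intro A B _ _ _ _ h hA
    refine hNk A B default default ?_ hA
    have : Gaifman.pairs (default : Fin 0 → A) (default : Fin 0 → B) = ∅ := by
      simp [Gaifman.pairs]
    rw [this]
    exact hΔ A B h
  -- `F` collects the subsets of `Δ` that are exactly the sentences true in some model of `ψ`. A
  -- structure satisfying all sentences of one such set satisfies `ψ` by `key`; sentences outside it
  -- are not negated.
  let F := Δ.powerset.filter fun D => ∃ (A : Type w) (_ : L.Structure A) (_ : Nonempty A),
    FirstOrder.Language.Sentence.Realize A ψ ∧ D = Δ.filter fun χ => χ.Realize A
  have hF : (Gaifman.LocalSentence.disj (F.image Gaifman.LocalSentence.conj)).HasSigns P := by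
    refine Gaifman.LocalSentence.hasSigns_disj fun χ hχ => ?_
    obtain ⟨D, hD, rfl⟩ := Finset.mem_image.1 hχ
    exact Gaifman.LocalSentence.hasSigns_conj fun χ hχ =>
      hs χ (Finset.mem_powerset.1 (Finset.mem_filter.1 hD).1 hχ)
  refine ⟨Gaifman.LocalSentence.disj (F.image Gaifman.LocalSentence.conj), fun M _ _ => ?_,
    fun S => ⟨fun h hS => h (hF S false hS), fun h hS => h (hF S true hS)⟩⟩
  rw [Gaifman.LocalSentence.realize_disj]
  constructor
  · intro hM
    refine ⟨_, Finset.mem_image_of_mem _ (Finset.mem_filter.2 ⟨Finset.mem_powerset.2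
      (Finset.filter_subset _ _), M, inferInstance, inferInstance, hM, rfl⟩), ?_⟩
    exact (Gaifman.LocalSentence.realize_conj M _).2 fun χ hχ => (Finset.mem_filter.1 hχ).2
  · rintro ⟨χ, hχ, hM⟩
    obtain ⟨D, hD, rfl⟩ := Finset.mem_image.1 hχ
    obtain ⟨-, A, _, _, hA, rfl⟩ := Finset.mem_filter.1 hD
    rw [Gaifman.LocalSentence.realize_conj] at hM
    exact key A M (fun χ hχ hχA => hM χ (Finset.mem_filter.2 ⟨hχ, hχA⟩)) hA
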